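/- For $n\in\mathbb N_0$ let $E_n(z)=(1-z)\exp\bigl(\sum_{k=1}^n z^k/k\bigr)$, $z\in\mathbb C$, be the Weierstrass primary factors (with $E_0(z)=1-z$), and for $n\in\mathbb N=\{1,2,\dots\}$ and $\alpha\in[0,1]$ let $$C_{n,\alpha}:=\sup_{z\in\mathbb C\setminus\{0,1\}}\frac{\ln|E_n(z)|}{|z|^{n+\alpha}}.$$ Let $W:[-e^{-1},\infty)\to[-1,\infty)$ be the principal branch of the Lambert function, i.e. the inverse of $[-1,\infty)\ni x\mapsto xe^x$, and let $\operatorname{Ei}(x)=\mathrm{p.v.}\int_{-\infty}^x \frac{e^t}{t}\,dt$ be the exponential integral. Then the function $x\mapsto e^x/x-\operatorname{Ei}(x)$ has a unique zero $x_0$ in $(0,\infty)$, and for every $\alpha\in[0,1]$ the following holds. For every $n\in\mathbb N$, the supremum $C_{n,\alpha}$ is finite and $$C_{n,1}\le C_{n,\alpha}\le(1-\alpha)C_{n,0}+\alpha C_{n,1}.$$ In particular, $$C_{1,\alpha}\le(1-\alpha)\bigl(1+W(e^{-1})\bigr)+\frac{\alpha}{2},$$ and for every $n\ge2$, $$C_{n,\alpha}\le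 1-\alpha\Bigl(1-\min\Bigl(x_0^{-1},\frac{n}{n+1}\Bigr)\Bigr)\le1.$$ -/

import Mathlib

open Filter Topology

/-- The Weierstrass primary factor `E_n(z) = (1 - z) exp (∑_{k=1}^n z^k / k)`; for `n = 0` the sum is
empty and `E_0(z) = 1 - z`. -/
noncomputable def primaryFactor (n : ℕ) (z : ℂ) : ℂ :=
  (1 - z) * Complex.exp (∑ k ∈ Finset.Icc 1 n, z ^ k / (k : ℂ))

/-- The quotient `ln |E_n(z)| / |z|^(n + α)`, used for `z ≠ 0, 1`. -/
noncomputable def growthQuotient (n : ℕ) (α : ℝ) (z : ℂ) : ℝ :=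
  Real.log ‖primaryFactor n z‖ / ‖z‖ ^ ((n : ℝ) + α)

/-- The set of all values `ln |E_n(z)| / |z|^(n + α)`, `z ∈ ℂ \ {0, 1}`. -/
def growthValues (n : ℕ) (α : ℝ) : Set ℝ :=
  growthQuotient n α '' ({0, 1}ᶜ : Set ℂ)

/-- The constant `C_{n,α}`, the supremum of `ln |E_n(z)| / |z|^(n + α)` over `z ∈ ℂ \ {0, 1}`. -/
noncomputable def growthConst (n : ℕ) (α : ℝ) : ℝ :=
  sSup (growthValues n α)

/-- The principal branch of the Lambert function: the inverse of `x ↦ x e^x` on `[-1, ∞)`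
(meaningful for arguments in `[-e⁻¹, ∞)`). -/
noncomputable def lambertW (y : ℝ) : ℝ :=
  Function.invFunOn (fun x : ℝ => x * Real.exp x) (Set.Ici (-1)) y

/-- The exponential integral `Ei(x)`, the principal value of `∫_{-∞}^x e^t / t dt`
(meaningful for `x ≠ 0`). -/
noncomputable def expIntegralEi (x : ℝ) : ℝ :=
  limUnder (𝓝[>] (0 : ℝ)) fun ε : ℝ =>
    ∫ t in {t : ℝ | t ≤ x ∧ ε < |t|}, Real.exp t / t

/-!
Write `L = ln |E_n|`. Since `E_n' / E_n = z^n / (z - 1)`, the gradient of `L` at `w` has length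
`|w|^n / |w - 1|`, and on a circle `|w| = r` the critical points `r e^{iφ}` of `L` are the solutions
of `r sin (n φ) = sin ((n + 1) φ)`. The solutions with `0 < φ ≤ π / (n + 1)` form a curve
`w(θ) = r(θ) e^{iθ}`, along which `r` decreases from `(n + 1) / n` to `0` and the gradient is radial,
of length `r^n g` with `g(θ) = sin (n θ) / sin θ = 1 / |w(θ) - 1|`.

The maximum of `L` on a circle of radius `r < (n + 1) / n` is attained on this curve. For arguments
below `θ`, `L` increases with the argument (`logFactor_circleMap_le_of_le`). For arguments `φ ≥ θ`,
the point `r e^{iφ}` is farther from `1` than `w(θ)`, so along the ray `L` grows no faster than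
along the curve, and the two agree where the ray meets the curve or at the origin
(`logFactor_circleMap_le_of_ge`). For `r ≥ (n + 1) / n` the same comparison shows that the maximum is
at `r` (`norm_primaryFactor_le_ofReal`). As `g` is antitone and at most `n`, `L / r^{n+1}` increases
with `r` along the curve and is at most `n / (n + 1)` (`succ_mul_logFactor_critPoint_le`,
`logFactor_critPoint_div_antitone`). All upper bounds are thereby reduced to real `x ≥ (n + 1) / n`:

* `L(x) ≤ n / (n + 1) x^{n+1}`, by comparing derivatives;
* `L(x) ≤ x^{n+1} / x₀`: the minimum of the difference is at `1 + x₀ / (n + 1)`, and there the claim is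
  a comparison of `∫ (1 + t / m)^n / t dt` with `Ei`, for `m = n + 1`
  (`logFactor_one_add_le_expIntegralEi`);
* `L(x) ≤ x^n` for `n ≥ 2`: the minimum of the difference is at `1 + s` with `s = 1 / (n - 1)`, where
  `L(1 + s) ≤ L(1 + s) - L(1 - s) = ∑ ((1 + s)^k - (1 - s)^k) / k` is estimated termwise;
* `L(x) ≤ (1 + W(1/e)) x` for `n = 1`, a tangent line of the logarithm.

The inequality `C_{n,1} ≤ C_{n,α}` is clear for the points with `|z| ≥ 1`, and for `|z| < 1` the
monotonicity of `L / r^{n+1}` along the critical curve leads to a point of the unit circle. The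
inequality `C_{n,α} ≤ (1 - α) C_{n,0} + α C_{n,1}` is Bernoulli's `r^{-α} ≤ (1 - α) + α r^{-1}`.
-/

/-! ### The logarithmic derivative of the primary factors -/

/-- The logarithm `ln |E_n(z)|` of the modulus of the primary factor; its value at the zero `z = 1`
of `E_n` is the junk value `0`. -/
noncomputable def logFactor (n : ℕ) (z : ℂ) : ℝ := Real.log ‖primaryFactor n z‖

lemma hasDerivAt_primaryFactor (n : ℕ) (z : ℂ) :
    HasDerivAt (primaryFactor n)
      (-(z ^ n) * Complex.exp (∑ k ∈ Finset.Icc 1 n, z ^ k / (k : ℂ))) z := by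
  have hS : HasDerivAt (fun z : ℂ => ∑ k ∈ Finset.Icc 1 n, z ^ k / (k : ℂ))
      (∑ k ∈ Finset.Icc 1 n, z ^ (k - 1)) z := by
    refine HasDerivAt.fun_sum fun k hk => ?_
    have hk0 : (k : ℂ) ≠ 0 := by
      have := (Finset.mem_Icc.1 hk).1
      exact_mod_cast (by omega : k ≠ 0)
    refine ((hasDerivAt_pow k z).div_const (k : ℂ)).congr_deriv ?_
    rw [mul_div_cancel_left₀ _ hk0]
  have hgeom : (1 - z) * ∑ k ∈ Finset.Icc 1 n, z ^ (k - 1) = 1 - z ^ n := by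
    clear hS
    induction n with
    | zero => simp
    | succ n ih =>
      rw [Finset.sum_Icc_succ_top (by omega), mul_add, ih, Nat.add_sub_cancel]
      ring
  have h := ((hasDerivAt_id z).const_sub 1).mul hS.cexp
  refine h.congr_deriv ?_
  simp only [id]
  linear_combination (Complex.exp (∑ k ∈ Finset.Icc 1 n, z ^ k / (k : ℂ))) * hgeom

lemma continuous_primaryFactor (n : ℕ) : Continuous (primaryFactor n) :=
  continuous_iff_continuousAt.2 fun z => (hasDerivAt_primaryFactor n z).continuousAt

lemma primaryFactor_ne_zero (n : ℕ) {z : ℂ} (hz : z ≠ 1) : primaryFactor n z ≠ 0 :=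
  mul_ne_zero (sub_ne_zero.2 hz.symm) (Complex.exp_ne_zero _)

lemma norm_primaryFactor_pos (n : ℕ) {z : ℂ} (hz : z ≠ 1) : 0 < ‖primaryFactor n z‖ :=
  norm_pos_iff.2 (primaryFactor_ne_zero n hz)

lemma logFactor_zero (n : ℕ) : logFactor n 0 = 0 := by
  have : ∑ k ∈ Finset.Icc 1 n, (0 : ℂ) ^ k / (k : ℂ) = 0 :=
    Finset.sum_eq_zero fun k hk => by
      have := (Finset.mem_Icc.1 hk).1
      rw [zero_pow (by omega), zero_div]
  simp [logFactor, primaryFactor, this]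

lemma norm_primaryFactor_conj (n : ℕ) (z : ℂ) :
    ‖primaryFactor n (starRingEnd ℂ z)‖ = ‖primaryFactor n z‖ := by
  have : primaryFactor n (starRingEnd ℂ z) = starRingEnd ℂ (primaryFactor n z) := by
    simp [primaryFactor, ← Complex.exp_conj]
  rw [this, Complex.norm_conj]

/-- `d ln |E_n(z)| = Re (z^n / (z - 1) dz)`, as a chain rule along a curve. -/
lemma hasDerivAt_logFactor_comp (n : ℕ) {γ : ℝ → ℂ} {γ' : ℂ} {t : ℝ} (h : HasDerivAt γ γ' t)
    (h1 : γ t ≠ 1) :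
    HasDerivAt (fun t => logFactor n (γ t)) (γ' * (γ t) ^ n / (γ t - 1)).re t := by
  have hE := (hasDerivAt_primaryFactor n (γ t)).comp t h
  have hne := primaryFactor_ne_zero n h1
  have hlog := (hE.norm_sq).log (by simpa using hne)
  have heq : (fun t => logFactor n (γ t)) =
      fun t => (1 / 2) * Real.log (‖(primaryFactor n ∘ γ) t‖ ^ 2) := by
    funext t
    simp [logFactor, Real.log_pow]
  rw [heq]
  refine (hlog.const_mul (1 / 2 : ℝ)).congr_deriv ?_
  have hquot : γ' * (γ t) ^ n / (γ t - 1) = (-γ t ^ n *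
      Complex.exp (∑ k ∈ Finset.Icc 1 n, γ t ^ k / ↑k) * γ') / primaryFactor n (γ t) := by
    have h1' : γ t - 1 ≠ 0 := sub_ne_zero.2 h1
    rw [div_eq_div_iff h1' hne, primaryFactor]
    ring
  rw [hquot, Complex.inner, Complex.div_re, Function.comp_apply, ← Complex.normSq_eq_norm_sq]
  simp only [Complex.mul_re, Complex.conj_re, Complex.conj_im]
  ring

lemma continuousAt_logFactor (n : ℕ) {z : ℂ} (hz : z ≠ 1) : ContinuousAt (logFactor n) z :=
  ((continuous_primaryFactor n).norm.continuousAt).log (norm_primaryFactor_pos n hz).ne'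

lemma logFactor_ofReal (n : ℕ) {x : ℝ} (hx : x ≠ 1) :
    logFactor n (x : ℂ) = Real.log |x - 1| + ∑ k ∈ Finset.Icc 1 n, x ^ k / (k : ℝ) := by
  have hsum : ∑ k ∈ Finset.Icc 1 n, (x : ℂ) ^ k / (k : ℂ) =
      ((∑ k ∈ Finset.Icc 1 n, x ^ k / (k : ℝ) : ℝ) : ℂ) := by push_cast; rfl
  have h1 : ‖(1 - x : ℂ)‖ = |x - 1| := by
    rw [abs_sub_comm, ← Real.norm_eq_abs, ← Complex.norm_real]; push_cast; rfl
  rw [logFactor, primaryFactor, hsum, norm_mul, Complex.norm_exp, Complex.ofReal_re, h1,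
    Real.log_mul (abs_ne_zero.2 (sub_ne_zero.2 hx)) (Real.exp_ne_zero _), Real.log_exp]

/-- Along the real axis, `d/dx ln |E_n(x)| = x^n / (x - 1)`. -/
lemma hasDerivAt_logFactor_ofReal (n : ℕ) {x : ℝ} (hx : x ≠ 1) :
    HasDerivAt (fun x : ℝ => logFactor n (x : ℂ)) (x ^ n / (x - 1)) x := by
  have h := hasDerivAt_logFactor_comp n (γ := fun x : ℝ => (x : ℂ)) (γ' := 1) (t := x)
    (Complex.ofRealCLM.hasDerivAt) (by exact_mod_cast hx)
  convert h using 1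
  rw [one_mul]
  norm_cast

/-! ### The critical curve -/

/-- The radius of the point of argument `θ` on the critical curve: the point
`w = critRadius n θ * e^{iθ}` is a critical point of `ln |E_n|` on the circle through it. -/
noncomputable def critRadius (n : ℕ) (θ : ℝ) : ℝ :=
  Real.sin ((n + 1 : ℝ) * θ) / Real.sin (n * θ)

/-- The critical curve, which for `0 < θ ≤ π / (n + 1)` joins `(n + 1) / n` (excluded) to `0`. -/
noncomputable def critPoint (n : ℕ) (θ : ℝ) : ℂ := circleMap 0 (critRadius n θ) θ

/-- The ratio `sin (n θ) / sin θ`; up to the factor `|w|^n`, it is the rate of growth of `ln |E_n|` in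
terms of `|w|` along the critical curve, and equals `1 / |w - 1|` there. -/
noncomputable def sinRatio (n : ℕ) (θ : ℝ) : ℝ := Real.sin (n * θ) / Real.sin θ

/-- The parameters `0 < θ ≤ π / (n + 1)` of the critical curve. -/
def critArgs (n : ℕ) : Set ℝ := Set.Ioc 0 (Real.pi / (n + 1))

lemma abs_sin_nat_mul_le (n : ℕ) (θ : ℝ) : |Real.sin (n * θ)| ≤ n * |Real.sin θ| := by
  induction n with
  | zero => simp
  | succ n ih =>
    push_cast
    rw [add_mul, one_mul, Real.sin_add]
    calc |Real.sin (n * θ) * Real.cos θ + Real.cos (n * θ) * Real.sin θ|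
        ≤ |Real.sin (n * θ) * Real.cos θ| + |Real.cos (n * θ) * Real.sin θ| := abs_add_le _ _
      _ = |Real.sin (n * θ)| * |Real.cos θ| + |Real.cos (n * θ)| * |Real.sin θ| := by
          rw [abs_mul, abs_mul]
      _ ≤ |Real.sin (n * θ)| * 1 + 1 * |Real.sin θ| := by
          gcongr
          · exact Real.abs_cos_le_one _
          · exact Real.abs_cos_le_one _
      _ ≤ n * |Real.sin θ| + |Real.sin θ| := by linarith
      _ = _ := by ring

section
variable {n : ℕ} {θ : ℝ}

lemma critArgs_mul_le (hθ : θ ∈ critArgs n) : (n + 1 : ℝ) * θ ≤ Real.pi := by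
  have := hθ.2
  rw [le_div_iff₀ (by positivity)] at this
  linarith

lemma sin_pos_of_mem_critArgs (hn : 1 ≤ n) (hθ : θ ∈ critArgs n) : 0 < Real.sin θ := by
  have h1 := critArgs_mul_le hθ
  have h0 := hθ.1
  have : (1 : ℝ) ≤ n := by exact_mod_cast hn
  exact Real.sin_pos_of_pos_of_lt_pi h0 (by nlinarith)

lemma sin_mul_pos_of_mem_critArgs (hn : 1 ≤ n) (hθ : θ ∈ critArgs n) :
    0 < Real.sin (n * θ) := by
  have h1 := critArgs_mul_le hθ
  have h0 := hθ.1
  have : (1 : ℝ) ≤ n := by exact_mod_cast hn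
  exact Real.sin_pos_of_pos_of_lt_pi (by positivity) (by nlinarith)

lemma critRadius_nonneg (hn : 1 ≤ n) (hθ : θ ∈ critArgs n) : 0 ≤ critRadius n θ := by
  have h1 := critArgs_mul_le hθ
  have h0 := hθ.1
  exact div_nonneg (Real.sin_nonneg_of_nonneg_of_le_pi (by positivity) h1)
    (sin_mul_pos_of_mem_critArgs hn hθ).le

lemma critRadius_pos (hn : 1 ≤ n) (hθ : θ ∈ critArgs n) (hlt : θ < Real.pi / (n + 1)) :
    0 < critRadius n θ := by
  have h0 := hθ.1
  rw [lt_div_iff₀ (by positivity)] at hlt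
  exact div_pos (Real.sin_pos_of_pos_of_lt_pi (by positivity) (by linarith))
    (sin_mul_pos_of_mem_critArgs hn hθ)

lemma critRadius_end (n : ℕ) : critRadius n (Real.pi / (n + 1)) = 0 := by
  have : (n + 1 : ℝ) * (Real.pi / (n + 1)) = Real.pi := by field_simp
  rw [critRadius, this, Real.sin_pi, zero_div]

/-- The derivative of the radius along the critical curve. -/
noncomputable def critRadiusDeriv (n : ℕ) (θ : ℝ) : ℝ :=
  (Real.sin (n * θ) * Real.cos ((n + 1 : ℝ) * θ) - n * Real.sin θ) / Real.sin (n * θ) ^ 2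

lemma hasDerivAt_critRadius (hn : 1 ≤ n) (hθ : θ ∈ critArgs n) :
    HasDerivAt (critRadius n) (critRadiusDeriv n θ) θ := by
  have hs := (sin_mul_pos_of_mem_critArgs hn hθ).ne'
  have h1 : HasDerivAt (fun θ : ℝ => Real.sin ((n + 1 : ℝ) * θ))
      (Real.cos ((n + 1 : ℝ) * θ) * (n + 1)) θ := by
    simpa using ((hasDerivAt_id θ).const_mul (n + 1 : ℝ)).sin
  have h2 : HasDerivAt (fun θ : ℝ => Real.sin ((n : ℝ) * θ)) (Real.cos ((n : ℝ) * θ) * n) θ := by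
    simpa using ((hasDerivAt_id θ).const_mul (n : ℝ)).sin
  refine (h1.div h2 hs).congr_deriv ?_
  have hsub : Real.sin ((n + 1 : ℝ) * θ) * Real.cos (n * θ) -
      Real.cos ((n + 1 : ℝ) * θ) * Real.sin (n * θ) = Real.sin θ := by
    rw [← Real.sin_sub]; congr 1; ring
  rw [critRadiusDeriv]
  congr 1
  linear_combination (-(n : ℝ)) * hsub

lemma critRadiusDeriv_neg (hn : 1 ≤ n) (hθ : θ ∈ critArgs n) : critRadiusDeriv n θ < 0 := by
  have hs := sin_mul_pos_of_mem_critArgs hn hθ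
  have hs1 := sin_pos_of_mem_critArgs hn hθ
  refine div_neg_of_neg_of_pos ?_ (by positivity)
  have hle := abs_sin_nat_mul_le n θ
  rw [abs_of_pos hs, abs_of_pos hs1] at hle
  have hcos : Real.cos ((n + 1 : ℝ) * θ) < 1 := by
    have h0 := hθ.1
    simpa using Real.cos_lt_cos_of_nonneg_of_le_pi le_rfl (critArgs_mul_le hθ) (by positivity)
  nlinarith

lemma critArgs_mono {θ' : ℝ} (hθ : θ ∈ critArgs n) (h0 : 0 < θ') (h : θ' ≤ θ) : θ' ∈ critArgs n :=
  ⟨h0, h.trans hθ.2⟩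

lemma convex_critArgs : Convex ℝ (critArgs n) := convex_Ioc _ _

lemma critRadius_strictAntiOn (hn : 1 ≤ n) : StrictAntiOn (critRadius n) (critArgs n) := by
  refine strictAntiOn_of_deriv_neg convex_critArgs
    (fun θ hθ => (hasDerivAt_critRadius hn hθ).continuousAt.continuousWithinAt) fun θ hθ => ?_
  have hθ' := interior_subset hθ
  rw [(hasDerivAt_critRadius hn hθ').deriv]
  exact critRadiusDeriv_neg hn hθ'

lemma sinRatio_pos (hn : 1 ≤ n) (hθ : θ ∈ critArgs n) : 0 < sinRatio n θ :=
  div_pos (sin_mul_pos_of_mem_critArgs hn hθ) (sin_pos_of_mem_critArgs hn hθ)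

lemma sinRatio_le (hn : 1 ≤ n) (hθ : θ ∈ critArgs n) : sinRatio n θ ≤ n := by
  have hs := sin_mul_pos_of_mem_critArgs hn hθ
  have hs1 := sin_pos_of_mem_critArgs hn hθ
  have hle := abs_sin_nat_mul_le n θ
  rw [abs_of_pos hs, abs_of_pos hs1] at hle
  rwa [sinRatio, div_le_iff₀ hs1]

/-- The inequality `n tan θ ≤ tan (n θ)` multiplied by `cos θ cos (n θ)`, which makes it valid beyond
`n θ = π / 2`. -/
lemma mul_cos_mul_sin_le (hn : 1 ≤ n) (hθ : θ ∈ critArgs n) :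
    n * Real.cos (n * θ) * Real.sin θ ≤ Real.sin (n * θ) * Real.cos θ := by
  have hder : ∀ t : ℝ, HasDerivAt
      (fun t : ℝ => Real.sin (n * t) * Real.cos t - n * Real.cos (n * t) * Real.sin t)
      (((n : ℝ) ^ 2 - 1) * (Real.sin (n * t) * Real.sin t)) t := by
    intro t
    have h1 : HasDerivAt (fun t : ℝ => Real.sin ((n : ℝ) * t)) (Real.cos ((n : ℝ) * t) * n) t := by
      simpa using ((hasDerivAt_id t).const_mul (n : ℝ)).sin
    have h2 : HasDerivAt (fun t : ℝ => Real.cos ((n : ℝ) * t)) (-Real.sin ((n : ℝ) * t) * n) t := by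
      simpa using ((hasDerivAt_id t).const_mul (n : ℝ)).cos
    refine ((h1.mul (Real.hasDerivAt_cos t)).sub
      ((h2.const_mul (n : ℝ)).mul (Real.hasDerivAt_sin t))).congr_deriv ?_
    ring
  have hmono := monotoneOn_of_deriv_nonneg (convex_Icc 0 θ)
    (fun t _ => (hder t).continuousAt.continuousWithinAt)
    (fun t _ => (hder t).differentiableAt.differentiableWithinAt) (fun t ht => by
      rw [interior_Icc] at ht
      have ht' := critArgs_mono hθ ht.1 ht.2.le
      rw [(hder t).deriv]
      have hs := sin_mul_pos_of_mem_critArgs hn ht'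
      have hs1 := sin_pos_of_mem_critArgs hn ht'
      have : (1 : ℝ) ≤ n := by exact_mod_cast hn
      exact mul_nonneg (by nlinarith) (by positivity))
  have := hmono (Set.left_mem_Icc.2 hθ.1.le) (Set.right_mem_Icc.2 hθ.1.le) hθ.1.le
  simp only [mul_zero, Real.sin_zero, zero_mul, sub_zero] at this
  linarith

lemma sinRatio_antitoneOn (hn : 1 ≤ n) : AntitoneOn (sinRatio n) (critArgs n) := by
  have hder : ∀ t ∈ critArgs n, HasDerivAt (sinRatio n)
      ((n * Real.cos (n * t) * Real.sin t - Real.sin (n * t) * Real.cos t) / Real.sin t ^ 2) t := by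
    intro t ht
    have h1 : HasDerivAt (fun t : ℝ => Real.sin ((n : ℝ) * t)) (Real.cos ((n : ℝ) * t) * n) t := by
      simpa using ((hasDerivAt_id t).const_mul (n : ℝ)).sin
    refine (h1.div (Real.hasDerivAt_sin t) (sin_pos_of_mem_critArgs hn ht).ne').congr_deriv ?_
    ring
  refine antitoneOn_of_deriv_nonpos convex_critArgs
    (fun t ht => (hder t ht).continuousAt.continuousWithinAt)
    (fun t ht => (hder t (interior_subset ht)).differentiableAt.differentiableWithinAt)
    fun t ht => ?_
  have ht' := interior_subset ht
  rw [(hder t ht').deriv]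
  exact div_nonpos_of_nonpos_of_nonneg (by linarith [mul_cos_mul_sin_le hn ht']) (by positivity)

lemma norm_critPoint (hn : 1 ≤ n) (hθ : θ ∈ critArgs n) : ‖critPoint n θ‖ = critRadius n θ := by
  rw [critPoint, norm_circleMap_zero, abs_of_nonneg (critRadius_nonneg hn hθ)]

/-- On the critical curve, `w - 1` has argument `(n + 1) θ`, the same as `w^{n+1}`. -/
lemma critPoint_sub_one_mul (hn : 1 ≤ n) (hθ : θ ∈ critArgs n) :
    (critPoint n θ - 1) * (sinRatio n θ : ℂ) = Complex.exp (((n + 1 : ℝ) * θ : ℝ) * Complex.I) := by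
  have hs := (sin_mul_pos_of_mem_critArgs hn hθ).ne'
  have hs1 := (sin_pos_of_mem_critArgs hn hθ).ne'
  have e1 : Real.sin ((n + 1 : ℝ) * θ) =
      Real.sin (n * θ) * Real.cos θ + Real.cos (n * θ) * Real.sin θ := by
    rw [← Real.sin_add]; congr 1; ring
  have e2 : Real.cos ((n + 1 : ℝ) * θ) =
      Real.cos (n * θ) * Real.cos θ - Real.sin (n * θ) * Real.sin θ := by
    rw [← Real.cos_add]; congr 1; ring
  have e3 := Real.sin_sq_add_cos_sq θ
  have e4 : critRadius n θ * sinRatio n θ = Real.sin ((n + 1 : ℝ) * θ) / Real.sin θ := by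
    rw [critRadius, sinRatio]; field_simp
  apply Complex.ext
  · rw [Complex.re_mul_ofReal, Complex.exp_ofReal_mul_I_re, Complex.sub_re, critPoint,
      circleMap_zero_re, Complex.one_re]
    calc (critRadius n θ * Real.cos θ - 1) * sinRatio n θ
        = (critRadius n θ * sinRatio n θ) * Real.cos θ - sinRatio n θ := by ring
      _ = _ := by
        rw [e4, sinRatio, e1, e2]
        field_simp
        linear_combination Real.sin (n * θ) * e3
  · rw [Complex.im_mul_ofReal, Complex.exp_ofReal_mul_I_im, Complex.sub_im, critPoint,
      circleMap_zero_im, Complex.one_im]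
    calc (critRadius n θ * Real.sin θ - 0) * sinRatio n θ
        = (critRadius n θ * sinRatio n θ) * Real.sin θ := by ring
      _ = _ := by
        rw [e4]
        field_simp

lemma critPoint_ne_one (hn : 1 ≤ n) (hθ : θ ∈ critArgs n) : critPoint n θ ≠ 1 := by
  intro h
  have := critPoint_sub_one_mul hn hθ
  rw [h, sub_self, zero_mul] at this
  exact Complex.exp_ne_zero _ this.symm

lemma norm_critPoint_sub_one (hn : 1 ≤ n) (hθ : θ ∈ critArgs n) :
    ‖critPoint n θ - 1‖ * sinRatio n θ = 1 := by
  have h := congrArg norm (critPoint_sub_one_mul hn hθ)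
  rwa [norm_mul, Complex.norm_exp_ofReal_mul_I, Complex.norm_real, Real.norm_eq_abs,
    abs_of_pos (sinRatio_pos hn hθ)] at h

lemma critRadius_tendsto (hn : 1 ≤ n) :
    Tendsto (critRadius n) (𝓝[>] 0) (𝓝 ((n + 1 : ℝ) / n)) := by
  have hlim : ∀ a : ℝ, Tendsto (fun θ : ℝ => Real.sin (a * θ) / θ) (𝓝[>] 0) (𝓝 a) := by
    intro a
    have h : HasDerivAt (fun θ : ℝ => Real.sin (a * θ)) a 0 := by
      simpa using ((hasDerivAt_id (0 : ℝ)).const_mul a).sin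
    have := h.tendsto_slope.mono_left (nhdsWithin_mono 0 (fun x (hx : 0 < x) => hx.ne'))
    refine this.congr fun x => ?_
    simp [slope_def_field]
  have hn0 : (n : ℝ) ≠ 0 := by exact_mod_cast (by omega : n ≠ 0)
  refine ((hlim (n + 1)).div (hlim n) hn0).congr' ?_
  filter_upwards [self_mem_nhdsWithin] with θ hθ
  have : θ ≠ 0 := (Set.mem_Ioi.1 hθ).ne'
  rw [critRadius]
  exact div_div_div_cancel_right₀ this _ _

lemma critPoint_tendsto (hn : 1 ≤ n) :
    Tendsto (critPoint n) (𝓝[>] 0) (𝓝 (((n + 1 : ℝ) / n : ℝ) : ℂ)) := by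
  have h1 := (Complex.continuous_ofReal.tendsto _).comp (critRadius_tendsto hn)
  have h2 : Tendsto (fun θ : ℝ => Complex.exp (θ * Complex.I)) (𝓝[>] 0) (𝓝 1) := by
    have : Continuous (fun θ : ℝ => Complex.exp (θ * Complex.I)) := by fun_prop
    simpa using (this.tendsto 0).mono_left nhdsWithin_le_nhds
  have h3 := h1.mul h2
  rw [mul_one] at h3
  exact h3.congr fun θ => (circleMap_zero _ _).symm

lemma critArgs_mem_nhdsGT (n : ℕ) : critArgs n ∈ 𝓝[>] (0 : ℝ) :=
  Ioc_mem_nhdsGT (by positivity)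

/-- Every radius in `(0, (n + 1) / n)` occurs on the critical curve. -/
lemma exists_critRadius_eq (hn : 1 ≤ n) {r : ℝ} (h0 : 0 < r) (hr : r < (n + 1 : ℝ) / n) :
    ∃ θ ∈ critArgs n, θ < Real.pi / (n + 1) ∧ critRadius n θ = r := by
  obtain ⟨t, ht, hrt⟩ : ∃ t ∈ critArgs n, r < critRadius n t := by
    have h : ∀ᶠ t in 𝓝[>] (0 : ℝ), t ∈ critArgs n := critArgs_mem_nhdsGT n
    exact (h.and ((critRadius_tendsto hn).eventually_const_lt hr)).exists
  have hcont : ContinuousOn (critRadius n) (Set.Icc t (Real.pi / (n + 1))) := fun x hx =>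
    (hasDerivAt_critRadius hn
      ⟨ht.1.trans_le hx.1, hx.2⟩).continuousAt.continuousWithinAt
  obtain ⟨θ, hθ, rfl⟩ := intermediate_value_Icc' ht.2 hcont
    ⟨(critRadius_end n).trans_le h0.le, hrt.le⟩
  refine ⟨θ, ⟨ht.1.trans_le hθ.1, hθ.2⟩, lt_of_le_of_ne hθ.2 ?_, rfl⟩
  rintro rfl
  rw [critRadius_end] at h0
  exact lt_irrefl _ h0

end

/-! ### Maxima of the modulus on circles -/

lemma circleMap_ne_one {ρ φ : ℝ} (hρ : 0 ≤ ρ) (hφ : φ ∈ Set.Ioc 0 Real.pi) :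
    circleMap 0 ρ φ ≠ 1 := by
  intro h
  have h1 : ρ = 1 := by
    have := congrArg norm h
    rwa [norm_circleMap_zero, abs_of_nonneg hρ, norm_one] at this
  have h2 := congrArg Complex.re h
  rw [circleMap_zero_re, h1, one_mul, Complex.one_re, ← Real.cos_zero] at h2
  exact (Real.cos_lt_cos_of_nonneg_of_le_pi le_rfl hφ.2 hφ.1).ne h2

lemma sq_norm_circleMap_sub_one (ρ φ : ℝ) :
    ‖circleMap 0 ρ φ - 1‖ ^ 2 = 1 - 2 * ρ * Real.cos φ + ρ ^ 2 := by
  rw [← Complex.normSq_eq_norm_sq, Complex.normSq_apply, Complex.sub_re, Complex.sub_im,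
    circleMap_zero_re, circleMap_zero_im, Complex.one_re, Complex.one_im]
  linear_combination ρ ^ 2 * Real.sin_sq_add_cos_sq φ

lemma norm_circleMap_sub_one_le {ρ φ ψ : ℝ} (hρ : 0 ≤ ρ) (h0 : 0 ≤ φ) (h : φ ≤ ψ)
    (hψ : ψ ≤ Real.pi) : ‖circleMap 0 ρ φ - 1‖ ≤ ‖circleMap 0 ρ ψ - 1‖ := by
  refine (pow_le_pow_iff_left₀ (norm_nonneg _) (norm_nonneg _) two_ne_zero).1 ?_
  rw [sq_norm_circleMap_sub_one, sq_norm_circleMap_sub_one]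
  have := Real.cos_le_cos_of_nonneg_of_le_pi h0 hψ h
  nlinarith

lemma logFactor_le_iff (n : ℕ) {z w : ℂ} (hz : z ≠ 1) (hw : w ≠ 1) :
    logFactor n z ≤ logFactor n w ↔ ‖primaryFactor n z‖ ≤ ‖primaryFactor n w‖ :=
  Real.log_le_log_iff (norm_primaryFactor_pos n hz) (norm_primaryFactor_pos n hw)

/-- The radial derivative of `ln |E_n|` at the point `ρ e^{iφ}`. -/
noncomputable def radialDeriv (n : ℕ) (ρ φ : ℝ) : ℝ :=
  (Complex.exp (φ * Complex.I) * (circleMap 0 ρ φ) ^ n / (circleMap 0 ρ φ - 1)).re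

lemma hasDerivAt_logFactor_radial (n : ℕ) {ρ φ : ℝ} (h : circleMap 0 ρ φ ≠ 1) :
    HasDerivAt (fun ρ => logFactor n (circleMap 0 ρ φ)) (radialDeriv n ρ φ) ρ := by
  refine hasDerivAt_logFactor_comp n (γ := fun ρ => circleMap 0 ρ φ) ?_ h
  have := (Complex.ofRealCLM.hasDerivAt (x := ρ)).mul_const (Complex.exp (φ * Complex.I))
  simp only [Complex.ofRealCLM_apply, Complex.ofReal_one, one_mul] at this
  exact this.congr_of_eventuallyEq (Eventually.of_forall fun ρ => circleMap_zero ρ φ)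

lemma hasDerivAt_logFactor_angular (n : ℕ) {ρ φ : ℝ} (h : circleMap 0 ρ φ ≠ 1) :
    HasDerivAt (fun φ => logFactor n (circleMap 0 ρ φ))
      (circleMap 0 ρ φ * Complex.I * (circleMap 0 ρ φ) ^ n / (circleMap 0 ρ φ - 1)).re φ :=
  hasDerivAt_logFactor_comp n (hasDerivAt_circleMap 0 ρ φ) h

lemma angularDeriv_eq (n : ℕ) (ρ φ : ℝ) :
    (circleMap 0 ρ φ * Complex.I * (circleMap 0 ρ φ) ^ n / (circleMap 0 ρ φ - 1)).re =
      ρ ^ (n + 1) * (Real.sin ((n + 1 : ℝ) * φ) - ρ * Real.sin (n * φ)) /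
        ‖circleMap 0 ρ φ - 1‖ ^ 2 := by
  have hpow : circleMap 0 ρ φ * Complex.I * (circleMap 0 ρ φ) ^ n =
      Complex.I * circleMap 0 (ρ ^ (n + 1)) ((n + 1 : ℝ) * φ) := by
    have := circleMap_zero_pow (n + 1) ρ φ
    push_cast at this
    rw [← this]; ring
  have hs : Real.sin (n * φ) = Real.sin ((n + 1 : ℝ) * φ) * Real.cos φ -
      Real.cos ((n + 1 : ℝ) * φ) * Real.sin φ := by
    rw [← Real.sin_sub]; congr 1; ring
  rw [hpow, Complex.div_re, Complex.normSq_eq_norm_sq, ← add_div]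
  congr 1
  simp only [Complex.mul_re, Complex.mul_im, Complex.I_re, Complex.I_im, circleMap_zero_re,
    circleMap_zero_im, Complex.sub_re, Complex.sub_im, Complex.one_re, Complex.one_im, hs]
  ring

lemma radialDeriv_le (n : ℕ) {ρ : ℝ} (φ : ℝ) (hρ : 0 ≤ ρ) :
    radialDeriv n ρ φ ≤ ρ ^ n / ‖circleMap 0 ρ φ - 1‖ := by
  calc radialDeriv n ρ φ
      ≤ ‖Complex.exp (φ * Complex.I) * (circleMap 0 ρ φ) ^ n / (circleMap 0 ρ φ - 1)‖ :=
        Complex.re_le_norm _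
    _ = ρ ^ n / ‖circleMap 0 ρ φ - 1‖ := by
      rw [norm_div, norm_mul, norm_pow, Complex.norm_exp_ofReal_mul_I, norm_circleMap_zero,
        abs_of_nonneg hρ, one_mul]

section
variable {n : ℕ} {θ φ : ℝ}

lemma logFactor_critPoint_end (n : ℕ) : logFactor n (critPoint n (Real.pi / (n + 1))) = 0 := by
  rw [critPoint, critRadius_end, circleMap_zero_radius]
  exact logFactor_zero n

/-- The angular derivative of `ln |E_n|` vanishes on the critical curve, so only the motion of the
radius contributes to the derivative along it. -/
lemma hasDerivAt_logFactor_critPoint (hn : 1 ≤ n) (hθ : θ ∈ critArgs n) :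
    HasDerivAt (fun θ => logFactor n (critPoint n θ))
      (critRadiusDeriv n θ * critRadius n θ ^ n * sinRatio n θ) θ := by
  have hr := (hasDerivAt_critRadius hn hθ).ofReal_comp
  have hexp : HasDerivAt (fun θ : ℝ => Complex.exp (θ * Complex.I))
      (Complex.exp (θ * Complex.I) * Complex.I) θ := by
    simpa using ((Complex.ofRealCLM.hasDerivAt (x := θ)).mul_const Complex.I).cexp
  have hγ : HasDerivAt (critPoint n) ((critRadiusDeriv n θ : ℂ) * Complex.exp (θ * Complex.I) +
      (critRadius n θ : ℂ) * (Complex.exp (θ * Complex.I) * Complex.I)) θ :=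
    (hr.mul hexp).congr_of_eventuallyEq (Eventually.of_forall fun t => circleMap_zero _ _)
  refine (hasDerivAt_logFactor_comp n hγ (critPoint_ne_one hn hθ)).congr_deriv ?_
  have hne := sub_ne_zero.2 (critPoint_ne_one hn hθ)
  have hsub := critPoint_sub_one_mul hn hθ
  have hexp' : Complex.exp (((n + 1 : ℝ) * θ : ℝ) * Complex.I) =
      Complex.exp (θ * Complex.I) ^ (n + 1) := by
    rw [← Complex.exp_nat_mul]; push_cast; ring_nf
  rw [hexp'] at hsub
  have : ((critRadiusDeriv n θ : ℂ) * Complex.exp (θ * Complex.I) +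
      (critRadius n θ : ℂ) * (Complex.exp (θ * Complex.I) * Complex.I)) * critPoint n θ ^ n /
        (critPoint n θ - 1) = ((critRadiusDeriv n θ * critRadius n θ ^ n * sinRatio n θ : ℝ) : ℂ) +
        ((critRadius n θ ^ (n + 1) * sinRatio n θ : ℝ) : ℂ) * Complex.I := by
    rw [div_eq_iff hne]
    have hz : critPoint n θ ^ n = (critRadius n θ : ℂ) ^ n * Complex.exp (θ * Complex.I) ^ n := by
      rw [critPoint, circleMap_zero, mul_pow]
    push_cast
    rw [hz]
    linear_combination (-((critRadiusDeriv n θ : ℂ) * (critRadius n θ : ℂ) ^ n +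
      (critRadius n θ : ℂ) ^ (n + 1) * Complex.I)) * hsub
  rw [this, Complex.add_re, Complex.ofReal_re, Complex.re_ofReal_mul, Complex.I_re]
  ring

/-- On the arc between the positive real axis and the critical curve, `|E_n|` grows with the
argument. -/
lemma logFactor_circleMap_le_of_le (hn : 1 ≤ n) (hθ : θ ∈ critArgs n) (h0 : 0 < φ) (h : φ ≤ θ) :
    logFactor n (circleMap 0 (critRadius n θ) φ) ≤ logFactor n (critPoint n θ) := by
  have hr := critRadius_nonneg hn hθ
  have hpi : θ ≤ Real.pi := by
    refine hθ.2.trans (div_le_self Real.pi_pos.le ?_)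
    have : (0 : ℝ) ≤ n := n.cast_nonneg
    linarith
  have hder : ∀ t ∈ Set.Icc φ θ, HasDerivAt
      (fun φ => logFactor n (circleMap 0 (critRadius n θ) φ)) _ t := fun t ht =>
    hasDerivAt_logFactor_angular n (circleMap_ne_one hr ⟨h0.trans_le ht.1, ht.2.trans hpi⟩)
  refine monotoneOn_of_deriv_nonneg (convex_Icc φ θ)
    (fun t ht => (hder t ht).continuousAt.continuousWithinAt)
    (fun t ht => (hder t (interior_subset ht)).differentiableAt.differentiableWithinAt)
    (fun t ht => ?_) (Set.left_mem_Icc.2 h) (Set.right_mem_Icc.2 h) h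
  have ht' := interior_subset ht
  have htc := critArgs_mono hθ (h0.trans_le ht'.1) ht'.2
  rw [(hder t ht').deriv, angularDeriv_eq]
  have hle : critRadius n θ ≤ critRadius n t :=
    (critRadius_strictAntiOn hn).antitoneOn htc hθ ht'.2
  have hle' : critRadius n θ * Real.sin (n * t) ≤ Real.sin ((n + 1 : ℝ) * t) := by
    rwa [← le_div_iff₀ (sin_mul_pos_of_mem_critArgs hn htc)]
  exact div_nonneg (mul_nonneg (by positivity) (by linarith)) (by positivity)

/-- Beyond the critical curve, the modulus `|w|^n / |w - 1|` of the logarithmic derivative of `E_n`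
at a point `w` is smaller than at the point of the critical curve on the same circle, where the whole
gradient is radial. Hence, as the radius grows, `ln |E_n|` increases at least as fast along the
critical curve as along the ray of argument `φ`. The comparison starts where the ray meets the curve,
or at the origin if it does not. -/
lemma logFactor_circleMap_le_of_ge (hn : 1 ≤ n) (hθ : θ ∈ critArgs n) (h : θ ≤ φ)
    (hφ : φ ≤ Real.pi) :
    logFactor n (circleMap 0 (critRadius n θ) φ) ≤ logFactor n (critPoint n θ) := by
  have h0φ : 0 < φ := hθ.1.trans_le h
  have hsub : ∀ t ∈ Set.Icc θ (min φ (Real.pi / (n + 1))), t ∈ critArgs n := fun t ht =>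
    ⟨hθ.1.trans_le ht.1, ht.2.trans (min_le_right _ _)⟩
  have hder : ∀ t ∈ Set.Icc θ (min φ (Real.pi / (n + 1))), HasDerivAt
      (fun t => logFactor n (circleMap 0 (critRadius n t) φ) - logFactor n (critPoint n t))
      (radialDeriv n (critRadius n t) φ * critRadiusDeriv n t -
        critRadiusDeriv n t * critRadius n t ^ n * sinRatio n t) t := fun t ht => by
    have htc := hsub t ht
    have h1 := hasDerivAt_logFactor_radial n
      (circleMap_ne_one (critRadius_nonneg hn htc) ⟨h0φ, hφ⟩)
    exact (HasDerivAt.comp t h1 (hasDerivAt_critRadius hn htc)).sub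
      (hasDerivAt_logFactor_critPoint hn htc)
  have hle : θ ≤ min φ (Real.pi / (n + 1)) := le_min h hθ.2
  have hmono := monotoneOn_of_deriv_nonneg (convex_Icc θ (min φ (Real.pi / (n + 1))))
    (fun t ht => (hder t ht).continuousAt.continuousWithinAt)
    (fun t ht => (hder t (interior_subset ht)).differentiableAt.differentiableWithinAt)
    (fun t ht => ?_) (Set.left_mem_Icc.2 hle) (Set.right_mem_Icc.2 hle) hle
  · have hend : logFactor n (circleMap 0 (critRadius n (min φ (Real.pi / (n + 1)))) φ) -
        logFactor n (critPoint n (min φ (Real.pi / (n + 1)))) = 0 := by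
      rcases le_total φ (Real.pi / (n + 1)) with hc | hc
      · rw [min_eq_left hc]
        exact sub_self _
      · rw [min_eq_right hc, logFactor_critPoint_end, critRadius_end, circleMap_zero_radius]
        simp [logFactor_zero]
    simp only [hend] at hmono
    linarith
  · have ht' := interior_subset ht
    have htc := hsub t ht'
    rw [(hder t ht').deriv]
    have htφ : t ≤ φ := ht'.2.trans (min_le_left _ _)
    have hr := critRadius_nonneg hn htc
    have hg := sinRatio_pos hn htc
    have hnorm := norm_critPoint_sub_one hn htc
    have hpos : 0 < ‖critPoint n t - 1‖ :=
      norm_pos_iff.2 (sub_ne_zero.2 (critPoint_ne_one hn htc))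
    have hdist : ‖critPoint n t - 1‖ ≤ ‖circleMap 0 (critRadius n t) φ - 1‖ := by
      exact norm_circleMap_sub_one_le hr htc.1.le htφ hφ
    have hbound : radialDeriv n (critRadius n t) φ ≤ critRadius n t ^ n * sinRatio n t :=
      calc radialDeriv n (critRadius n t) φ
          ≤ critRadius n t ^ n / ‖circleMap 0 (critRadius n t) φ - 1‖ := radialDeriv_le n φ hr
        _ ≤ critRadius n t ^ n / ‖critPoint n t - 1‖ := by gcongr
        _ = critRadius n t ^ n * sinRatio n t := by
          rw [div_eq_iff hpos.ne']
          linear_combination (-(critRadius n t ^ n)) * hnorm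
    nlinarith [critRadiusDeriv_neg hn htc]

lemma norm_primaryFactor_circleMap_zero_le {ρ M : ℝ}
    (h : ∀ φ ∈ Set.Ioc 0 Real.pi, ‖primaryFactor n (circleMap 0 ρ φ)‖ ≤ M) :
    ∀ φ ∈ Set.Icc 0 Real.pi, ‖primaryFactor n (circleMap 0 ρ φ)‖ ≤ M := by
  intro φ hφ
  have hcont : Continuous fun φ => ‖primaryFactor n (circleMap 0 ρ φ)‖ :=
    ((continuous_primaryFactor n).comp (continuous_circleMap 0 ρ)).norm
  rcases hφ.1.eq_or_lt with rfl | h0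
  · refine le_of_tendsto ((hcont.tendsto 0).mono_left (nhdsWithin_le_nhds (s := Set.Ioi 0))) ?_
    filter_upwards [Ioc_mem_nhdsGT Real.pi_pos] with t ht using h t ht
  · exact h φ ⟨h0, hφ.2⟩

/-- A bound for `|E_n|` on an upper semicircle holds on the circle. -/
lemma norm_primaryFactor_le_of_circleMap {M : ℝ} {z : ℂ}
    (h : ∀ φ ∈ Set.Ioc 0 Real.pi, ‖primaryFactor n (circleMap 0 ‖z‖ φ)‖ ≤ M) :
    ‖primaryFactor n z‖ ≤ M := by
  have h' := norm_primaryFactor_circleMap_zero_le h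
  have hz : circleMap 0 ‖z‖ z.arg = z := by rw [circleMap_zero, Complex.norm_mul_exp_arg_mul_I]
  rcases le_total 0 z.arg with h0 | h0
  · have := h' _ ⟨h0, Complex.arg_le_pi z⟩
    rwa [hz] at this
  · have := h' (-z.arg) ⟨by linarith, by linarith [Complex.neg_pi_lt_arg z]⟩
    rwa [← conj_circleMap_zero, hz, norm_primaryFactor_conj] at this

/-- On a circle of radius less than `(n + 1) / n` the maximum of `|E_n|` is attained on the critical
curve. -/
lemma norm_primaryFactor_le_critPoint (hn : 1 ≤ n) (hθ : θ ∈ critArgs n) {z : ℂ}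
    (hz : ‖z‖ = critRadius n θ) : ‖primaryFactor n z‖ ≤ ‖primaryFactor n (critPoint n θ)‖ := by
  refine norm_primaryFactor_le_of_circleMap fun φ hφ => ?_
  rw [hz, ← logFactor_le_iff n (circleMap_ne_one (critRadius_nonneg hn hθ) hφ)
    (critPoint_ne_one hn hθ)]
  rcases le_total φ θ with h | h
  · exact logFactor_circleMap_le_of_le hn hθ hφ.1 h
  · exact logFactor_circleMap_le_of_ge hn hθ h hφ.2

lemma one_lt_succ_div (hn : 1 ≤ n) : (1 : ℝ) < (n + 1 : ℝ) / n := by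
  have : (0 : ℝ) < n := by exact_mod_cast hn
  rw [lt_div_iff₀ this]
  linarith

/-- On a circle of radius `r ≥ (n + 1) / n` the maximum of `|E_n|` is attained at `r`. -/
lemma norm_primaryFactor_le_ofReal (hn : 1 ≤ n) {r : ℝ} (hr : (n + 1 : ℝ) / n ≤ r) {z : ℂ}
    (hz : ‖z‖ = r) : ‖primaryFactor n z‖ ≤ ‖primaryFactor n (r : ℂ)‖ := by
  have h1 := one_lt_succ_div hn
  refine norm_primaryFactor_le_of_circleMap fun φ hφ => ?_
  have hbase : ‖primaryFactor n (circleMap 0 ((n + 1 : ℝ) / n) φ)‖ ≤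
      ‖primaryFactor n (((n + 1 : ℝ) / n : ℝ) : ℂ)‖ := by
    have hc : Continuous fun ρ => ‖primaryFactor n (circleMap 0 ρ φ)‖ := by
      refine ((continuous_primaryFactor n).comp ?_).norm
      simp only [circleMap]
      fun_prop
    refine le_of_tendsto_of_tendsto ((hc.tendsto _).comp (critRadius_tendsto hn))
      (((continuous_primaryFactor n).norm.tendsto _).comp (critPoint_tendsto hn)) ?_
    filter_upwards [critArgs_mem_nhdsGT n] with t ht
    refine norm_primaryFactor_le_critPoint hn ht ?_
    rw [norm_circleMap_zero, abs_of_nonneg (critRadius_nonneg hn ht)]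
  have hof : ∀ t : ℝ, 1 < t → (t : ℂ) ≠ 1 := fun t ht => by exact_mod_cast ht.ne'
  have hder : ∀ t ∈ Set.Icc ((n + 1 : ℝ) / n) r, HasDerivAt
      (fun t => logFactor n (circleMap 0 t φ) - logFactor n (t : ℂ))
      (radialDeriv n t φ - t ^ n / (t - 1)) t := fun t ht =>
    (hasDerivAt_logFactor_radial n (circleMap_ne_one (by linarith [ht.1]) hφ)).sub
      (hasDerivAt_logFactor_ofReal n (h1.trans_le ht.1).ne')
  have hanti := antitoneOn_of_deriv_nonpos (convex_Icc ((n + 1 : ℝ) / n) r)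
    (fun t ht => (hder t ht).continuousAt.continuousWithinAt)
    (fun t ht => (hder t (interior_subset ht)).differentiableAt.differentiableWithinAt)
    (fun t ht => ?_) (Set.left_mem_Icc.2 hr) (Set.right_mem_Icc.2 hr) hr
  · rw [← logFactor_le_iff n (circleMap_ne_one (by linarith) hφ) (hof _ h1)] at hbase
    rw [hz, ← logFactor_le_iff n (circleMap_ne_one (by linarith) hφ) (hof _ (h1.trans_le hr))]
    simp only at hanti
    linarith
  · have ht' := interior_subset ht
    rw [(hder t ht').deriv]
    have ht1 : 1 < t := h1.trans_le ht'.1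
    have hdist : t - 1 ≤ ‖circleMap 0 t φ - 1‖ := by
      have := norm_sub_norm_le (circleMap 0 t φ) 1
      rwa [norm_circleMap_zero, abs_of_pos (by linarith), norm_one] at this
    have : t ^ n / ‖circleMap 0 t φ - 1‖ ≤ t ^ n / (t - 1) := by
      have : 0 < t - 1 := by linarith
      gcongr
    linarith [radialDeriv_le n φ (by linarith : 0 ≤ t)]

/-- With the radius `r` as parameter, the derivative of `ln |E_n|` along the critical curve is `r^n g`,
and `g = sinRatio n` increases with `r`; bounding it by its final value and integrating gives the
claim. -/
lemma succ_mul_logFactor_critPoint_le (hn : 1 ≤ n) (hθ : θ ∈ critArgs n) :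
    (n + 1 : ℝ) * logFactor n (critPoint n θ) ≤ sinRatio n θ * critRadius n θ ^ (n + 1) := by
  have hsub : ∀ t ∈ Set.Icc θ (Real.pi / (n + 1)), t ∈ critArgs n := fun t ht =>
    ⟨hθ.1.trans_le ht.1, ht.2⟩
  have hder : ∀ t ∈ Set.Icc θ (Real.pi / (n + 1)), HasDerivAt
      (fun t => (n + 1 : ℝ) * logFactor n (critPoint n t) - sinRatio n θ * critRadius n t ^ (n + 1))
      ((n + 1 : ℝ) * critRadiusDeriv n t * critRadius n t ^ n * (sinRatio n t - sinRatio n θ)) t :=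
    fun t ht => by
      have htc := hsub t ht
      refine (((hasDerivAt_logFactor_critPoint hn htc).const_mul (n + 1 : ℝ)).sub
        (((hasDerivAt_critRadius hn htc).pow (n + 1)).const_mul (sinRatio n θ))).congr_deriv ?_
      rw [Nat.add_sub_cancel]
      push_cast
      ring
  have hmono := monotoneOn_of_deriv_nonneg (convex_Icc θ (Real.pi / (n + 1)))
    (fun t ht => (hder t ht).continuousAt.continuousWithinAt)
    (fun t ht => (hder t (interior_subset ht)).differentiableAt.differentiableWithinAt)
    (fun t ht => ?_) (Set.left_mem_Icc.2 hθ.2) (Set.right_mem_Icc.2 hθ.2) hθ.2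
  · simp only [logFactor_critPoint_end, critRadius_end] at hmono
    rw [zero_pow (by omega)] at hmono
    linarith
  · have ht' := interior_subset ht
    have htc := hsub t ht'
    rw [(hder t ht').deriv]
    have h1 := critRadiusDeriv_neg hn htc
    have h2 := pow_nonneg (critRadius_nonneg hn htc) n
    have h3 := sinRatio_antitoneOn hn hθ htc ht'.1
    have h4 : 0 ≤ -critRadiusDeriv n t * critRadius n t ^ n * (sinRatio n θ - sinRatio n t) :=
      mul_nonneg (mul_nonneg (by linarith) h2) (by linarith)
    have h5 : (0 : ℝ) ≤ (n + 1 : ℝ) := by positivity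
    nlinarith [mul_nonneg h5 h4]

/-- The quotient `ln |E_n(w)| / |w|^{n+1}` increases with `|w|` along the critical curve. -/
lemma logFactor_critPoint_div_antitone (hn : 1 ≤ n) :
    AntitoneOn (fun θ => logFactor n (critPoint n θ) / critRadius n θ ^ (n + 1))
      (Set.Ioo 0 (Real.pi / (n + 1))) := by
  have hder : ∀ t ∈ Set.Ioo 0 (Real.pi / (n + 1)), HasDerivAt
      (fun θ => logFactor n (critPoint n θ) / critRadius n θ ^ (n + 1))
      (critRadiusDeriv n t * critRadius n t ^ n * (sinRatio n t * critRadius n t ^ (n + 1) -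
        (n + 1 : ℝ) * logFactor n (critPoint n t)) / (critRadius n t ^ (n + 1)) ^ 2) t :=
    fun t ht => by
      have htc : t ∈ critArgs n := ⟨ht.1, ht.2.le⟩
      refine ((hasDerivAt_logFactor_critPoint hn htc).div
        ((hasDerivAt_critRadius hn htc).pow (n + 1))
        (pow_pos (critRadius_pos hn htc ht.2) _).ne').congr_deriv ?_
      rw [Nat.add_sub_cancel, Pi.pow_apply]
      push_cast
      ring
  refine antitoneOn_of_deriv_nonpos (convex_Ioo _ _)
    (fun t ht => (hder t ht).continuousAt.continuousWithinAt)
    (fun t ht => (hder t (interior_subset ht)).differentiableAt.differentiableWithinAt)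
    fun t ht => ?_
  have ht' := interior_subset ht
  have htc : t ∈ critArgs n := ⟨ht'.1, ht'.2.le⟩
  rw [(hder t ht').deriv]
  refine div_nonpos_of_nonpos_of_nonneg (mul_nonpos_of_nonpos_of_nonneg
    (mul_nonpos_of_nonpos_of_nonneg (critRadiusDeriv_neg hn htc).le
      (pow_nonneg (critRadius_nonneg hn htc) n)) ?_) (by positivity)
  linarith [succ_mul_logFactor_critPoint_le hn htc]

end

/-! ### Bounds by powers of the modulus -/

section
variable {n : ℕ}

/-- It suffices to test a bound `ln |E_n(z)| ≤ c |z|^{n+1}` at the real points `x ≥ (n + 1) / n`. -/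
lemma logFactor_le_of_forall_ofReal_le (hn : 1 ≤ n) {c : ℝ}
    (h : ∀ x : ℝ, (n + 1 : ℝ) / n ≤ x → logFactor n (x : ℂ) ≤ c * x ^ (n + 1)) {z : ℂ}
    (hz : z ≠ 1) : logFactor n z ≤ c * ‖z‖ ^ (n + 1) := by
  have hr1 := one_lt_succ_div hn
  rcases eq_or_ne z 0 with rfl | hz0
  · simp [logFactor_zero]
  rcases le_or_gt ((n + 1 : ℝ) / n) ‖z‖ with hr | hr
  · refine le_trans ?_ (h _ hr)
    have h1 : ((‖z‖ : ℝ) : ℂ) ≠ 1 := by exact_mod_cast (hr1.trans_le hr).ne'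
    exact (logFactor_le_iff n hz h1).2 (norm_primaryFactor_le_ofReal hn hr rfl)
  · obtain ⟨θ, hθ, hlt, hrad⟩ := exists_critRadius_eq hn (norm_pos_iff.2 hz0) hr
    have hle := (logFactor_le_iff n hz (critPoint_ne_one hn hθ)).2
      (norm_primaryFactor_le_critPoint hn hθ hrad.symm)
    have hsup : logFactor n (critPoint n θ) / critRadius n θ ^ (n + 1) ≤ c := by
      have h1 : ((((n + 1 : ℝ) / n : ℝ)) : ℂ) ≠ 1 := by exact_mod_cast hr1.ne'
      have hlim := ((continuousAt_logFactor n h1).tendsto.comp (critPoint_tendsto hn)).div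
        ((critRadius_tendsto hn).pow (n + 1)) (by positivity)
      calc logFactor n (critPoint n θ) / critRadius n θ ^ (n + 1)
          ≤ logFactor n (((n + 1 : ℝ) / n : ℝ) : ℂ) / ((n + 1 : ℝ) / n) ^ (n + 1) := by
            refine ge_of_tendsto hlim ?_
            filter_upwards [Ioc_mem_nhdsGT hθ.1] with t ht
            exact logFactor_critPoint_div_antitone hn ⟨ht.1, ht.2.trans_lt hlt⟩ ⟨hθ.1, hlt⟩ ht.2
        _ ≤ c := by
            rw [div_le_iff₀ (by positivity)]
            exact h _ le_rfl
    rw [div_le_iff₀ (pow_pos (critRadius_pos hn hθ hlt) _), hrad] at hsup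
    exact hle.trans hsup

lemma logFactor_ofReal_le_div (hn : 1 ≤ n) {x : ℝ} (hx : (n + 1 : ℝ) / n ≤ x) :
    logFactor n (x : ℂ) ≤ n / (n + 1 : ℝ) * x ^ (n + 1) := by
  have hr1 := one_lt_succ_div hn
  have hn0 : (0 : ℝ) < n := by exact_mod_cast hn
  have hbase : logFactor n (((n + 1 : ℝ) / n : ℝ) : ℂ) ≤
      n / (n + 1 : ℝ) * ((n + 1 : ℝ) / n) ^ (n + 1) := by
    have h1 : ((((n + 1 : ℝ) / n : ℝ)) : ℂ) ≠ 1 := by exact_mod_cast hr1.ne'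
    refine le_of_tendsto_of_tendsto
      ((continuousAt_logFactor n h1).tendsto.comp (critPoint_tendsto hn))
      (((critRadius_tendsto hn).pow (n + 1)).const_mul _) ?_
    filter_upwards [critArgs_mem_nhdsGT n] with t ht
    have h2 := succ_mul_logFactor_critPoint_le hn ht
    have h3 := mul_le_mul_of_nonneg_right (sinRatio_le hn ht)
      (pow_nonneg (critRadius_nonneg hn ht) (n + 1))
    rw [div_mul_eq_mul_div, le_div_iff₀ (by positivity)]
    simp only [Function.comp_apply]
    linarith
  have hder : ∀ t ∈ Set.Icc ((n + 1 : ℝ) / n) x, HasDerivAt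
      (fun t : ℝ => n / (n + 1 : ℝ) * t ^ (n + 1) - logFactor n (t : ℂ))
      (n * t ^ n - t ^ n / (t - 1)) t := fun t ht => by
    refine (((hasDerivAt_pow (n + 1) t).const_mul (n / (n + 1 : ℝ))).sub
      (hasDerivAt_logFactor_ofReal n (hr1.trans_le ht.1).ne')).congr_deriv ?_
    rw [Nat.add_sub_cancel]
    push_cast
    field_simp
  have hmono := monotoneOn_of_deriv_nonneg (convex_Icc ((n + 1 : ℝ) / n) x)
    (fun t ht => (hder t ht).continuousAt.continuousWithinAt)
    (fun t ht => (hder t (interior_subset ht)).differentiableAt.differentiableWithinAt)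
    (fun t ht => ?_) (Set.left_mem_Icc.2 hx) (Set.right_mem_Icc.2 hx) hx
  · simp only at hmono
    linarith
  · have ht' := interior_subset ht
    rw [(hder t ht').deriv]
    have ht1 := hr1.trans_le ht'.1
    have h2 : 1 ≤ n * (t - 1) := by
      have := (div_le_iff₀ hn0).1 ht'.1
      linarith
    rw [sub_nonneg, div_le_iff₀ (by linarith)]
    have := mul_le_mul_of_nonneg_left h2 (pow_nonneg (by linarith : 0 ≤ t) n)
    linarith

lemma logFactor_le_div (hn : 1 ≤ n) {z : ℂ} (hz : z ≠ 1) :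
    logFactor n z ≤ n / (n + 1 : ℝ) * ‖z‖ ^ (n + 1) :=
  logFactor_le_of_forall_ofReal_le hn (fun _ hx => logFactor_ofReal_le_div hn hx) hz

/-- A function on `(a, ∞)` that decreases up to `c` and increases from there on is nonnegative if it
is so at `c`. -/
lemma nonneg_of_deriv_sign {f f' : ℝ → ℝ} {a c : ℝ} (hac : a < c)
    (hd : ∀ x, a < x → HasDerivAt f (f' x) x) (hl : ∀ x, a < x → x ≤ c → f' x ≤ 0)
    (hr : ∀ x, c ≤ x → 0 ≤ f' x) (hc : 0 ≤ f c) {x : ℝ} (hx : a < x) : 0 ≤ f x := by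
  rcases le_total x c with h | h
  · have hanti : AntitoneOn f (Set.Icc x c) := antitoneOn_of_deriv_nonpos (convex_Icc x c)
      (fun t ht => (hd t (hx.trans_le ht.1)).continuousAt.continuousWithinAt)
      (fun t ht => (hd t (hx.trans_le
        (interior_subset ht).1)).differentiableAt.differentiableWithinAt)
      (fun t ht => by
        have ht' := interior_subset ht
        rw [(hd t (hx.trans_le ht'.1)).deriv]
        exact hl t (hx.trans_le ht'.1) ht'.2)
    exact hc.trans (hanti (Set.left_mem_Icc.2 h) (Set.right_mem_Icc.2 h) h)
  · have hmono : MonotoneOn f (Set.Icc c x) := monotoneOn_of_deriv_nonneg (convex_Icc c x)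
      (fun t ht => (hd t (hac.trans_le ht.1)).continuousAt.continuousWithinAt)
      (fun t ht => (hd t (hac.trans_le
        (interior_subset ht).1)).differentiableAt.differentiableWithinAt)
      (fun t ht => by
        have ht' := interior_subset ht
        rw [(hd t (hac.trans_le ht'.1)).deriv]
        exact hr t ht'.1)
    exact hc.trans (hmono (Set.left_mem_Icc.2 h) (Set.right_mem_Icc.2 h) h)

lemma logFactor_ofReal_nonpos (n : ℕ) {u : ℝ} (h0 : 0 ≤ u) (h1 : u < 1) :
    logFactor n (u : ℂ) ≤ 0 := by
  have hd : ∀ t ∈ Set.Icc 0 u, HasDerivAt (fun t : ℝ => logFactor n (t : ℂ)) (t ^ n / (t - 1)) t :=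
    fun t ht => hasDerivAt_logFactor_ofReal n (ht.2.trans_lt h1).ne
  have := antitoneOn_of_deriv_nonpos (convex_Icc 0 u)
    (fun t ht => (hd t ht).continuousAt.continuousWithinAt)
    (fun t ht => (hd t (interior_subset ht)).differentiableAt.differentiableWithinAt)
    (fun t ht => by
      have ht' := interior_subset ht
      rw [(hd t ht').deriv]
      exact div_nonpos_of_nonneg_of_nonpos (pow_nonneg ht'.1 n) (by linarith [ht'.2]))
    (Set.left_mem_Icc.2 h0) (Set.right_mem_Icc.2 h0) h0
  simpa [logFactor_zero] using this

/-- `((1 + s)^k - (1 - s)^k) / k` is nondecreasing in `k`, in a form free of quotients. -/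
lemma pow_sub_pow_le_mul {s : ℝ} (h0 : 0 ≤ s) (h1 : s ≤ 1) (k : ℕ) :
    (1 + s) ^ k - (1 - s) ^ k ≤ k * s * ((1 + s) ^ k + (1 - s) ^ k) := by
  induction k with
  | zero => simp
  | succ k ih =>
    have hle : (1 - s) ^ k ≤ (1 + s) ^ k := pow_le_pow_left₀ (by linarith) (by linarith) k
    have h2 : 0 ≤ (k + 1 : ℝ) * s ^ 2 * ((1 + s) ^ k - (1 - s) ^ k) :=
      mul_nonneg (by positivity) (by linarith)
    push_cast
    rw [pow_succ, pow_succ]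
    linarith

lemma pow_sub_pow_div_le {s : ℝ} (h0 : 0 ≤ s) (h1 : s ≤ 1) {k : ℕ} (hk : 1 ≤ k) (hkn : k ≤ n) :
    ((1 + s) ^ k - (1 - s) ^ k) / k ≤ ((1 + s) ^ n - (1 - s) ^ n) / n := by
  induction n, hkn using Nat.le_induction with
  | base => exact le_rfl
  | succ j hkj ih =>
    refine ih.trans ?_
    have hj : (0 : ℝ) < j := by exact_mod_cast hk.trans hkj
    have := pow_sub_pow_le_mul h0 h1 j
    rw [div_le_div_iff₀ hj (by positivity), pow_succ, pow_succ]
    push_cast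
    linarith

lemma logFactor_one_add_le (hn : 1 ≤ n) {s : ℝ} (h0 : 0 < s) (h1 : s ≤ 1) :
    logFactor n ((1 + s : ℝ) : ℂ) ≤ (1 + s) ^ n := by
  have hneg := logFactor_ofReal_nonpos n (sub_nonneg.2 h1) (sub_lt_self 1 h0)
  rw [logFactor_ofReal n (by linarith)] at hneg ⊢
  have e1 : |1 + s - 1| = s := by rw [add_sub_cancel_left, abs_of_pos h0]
  have e2 : |1 - s - 1| = s := by rw [sub_sub_cancel_left, abs_neg, abs_of_pos h0]
  rw [e1]
  rw [e2] at hneg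
  have hsum : ∑ k ∈ Finset.Icc 1 n, (1 + s) ^ k / (k : ℝ) -
      ∑ k ∈ Finset.Icc 1 n, (1 - s) ^ k / (k : ℝ) ≤ (1 + s) ^ n - (1 - s) ^ n := by
    rw [← Finset.sum_sub_distrib]
    calc ∑ k ∈ Finset.Icc 1 n, ((1 + s) ^ k / (k : ℝ) - (1 - s) ^ k / (k : ℝ))
        ≤ ∑ k ∈ Finset.Icc 1 n, ((1 + s) ^ n - (1 - s) ^ n) / (n : ℝ) := by
          refine Finset.sum_le_sum fun k hk => ?_
          rw [← sub_div]
          exact pow_sub_pow_div_le h0.le h1 (Finset.mem_Icc.1 hk).1 (Finset.mem_Icc.1 hk).2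
      _ = (1 + s) ^ n - (1 - s) ^ n := by
          have hn0 : (n : ℝ) ≠ 0 := by exact_mod_cast (by omega : n ≠ 0)
          rw [Finset.sum_const, Nat.card_Icc, Nat.add_sub_cancel, nsmul_eq_mul]
          field_simp
  have : 0 ≤ (1 - s) ^ n := pow_nonneg (by linarith) n
  linarith

lemma logFactor_ofReal_le_pow (hn : 2 ≤ n) {x : ℝ} (hx : 1 < x) : logFactor n (x : ℂ) ≤ x ^ n := by
  have hn1 : (0 : ℝ) < (n : ℝ) - 1 := by
    have : (2 : ℝ) ≤ n := by exact_mod_cast hn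
    linarith
  -- the minimum of `x ^ n - ln |E_n(x)|` is at `n / (n - 1)`
  have hfac : ∀ t : ℝ, 1 < t → n * t ^ (n - 1) - t ^ n / (t - 1) =
      t ^ (n - 1) * (((n : ℝ) - 1) * t - n) / (t - 1) := fun t ht => by
    have h1 : t - 1 ≠ 0 := by linarith
    obtain ⟨m, rfl⟩ : ∃ m, n = m + 1 := ⟨n - 1, by omega⟩
    rw [Nat.add_sub_cancel]
    field_simp
    ring
  have hc : 1 + 1 / ((n : ℝ) - 1) = n / ((n : ℝ) - 1) := by field_simp; ring
  have key : 0 ≤ x ^ n - logFactor n (x : ℂ) := by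
    refine nonneg_of_deriv_sign (f := fun x : ℝ => x ^ n - logFactor n (x : ℂ))
      (f' := fun t => n * t ^ (n - 1) - t ^ n / (t - 1)) (a := 1) (c := 1 + 1 / ((n : ℝ) - 1))
      (by simpa using hn1) (fun t ht => (hasDerivAt_pow n t).sub
        (hasDerivAt_logFactor_ofReal n ht.ne')) (fun t ht htc => ?_) (fun t htc => ?_) ?_ hx
    · rw [hfac t ht]
      rw [hc, le_div_iff₀ hn1] at htc
      exact div_nonpos_of_nonpos_of_nonneg (mul_nonpos_of_nonneg_of_nonpos
        (pow_nonneg (by linarith) _) (by linarith)) (by linarith)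
    · have ht : 1 < t := lt_of_lt_of_le (by simpa using hn1) htc
      rw [hfac t ht]
      rw [hc, div_le_iff₀ hn1] at htc
      exact div_nonneg (mul_nonneg (pow_nonneg (by linarith) _) (by linarith)) (by linarith)
    · have hs : 1 / ((n : ℝ) - 1) ≤ 1 := by
        rw [div_le_one hn1]
        have : (2 : ℝ) ≤ n := by exact_mod_cast hn
        linarith
      exact sub_nonneg.2 (logFactor_one_add_le (by omega) (by positivity) hs)
  linarith

/-- A bound `ln |E_n(z)| ≤ K |z|^n` with `K ≥ 1` need only be tested at the real points
`x ≥ (n + 1) / n`. -/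
lemma logFactor_le_mul_pow (hn : 1 ≤ n) {K : ℝ} (hK : 1 ≤ K)
    (h : ∀ x : ℝ, (n + 1 : ℝ) / n ≤ x → logFactor n (x : ℂ) ≤ K * x ^ n) {z : ℂ} (hz : z ≠ 1) :
    logFactor n z ≤ K * ‖z‖ ^ n := by
  have hr1 := one_lt_succ_div hn
  have hn0 : (0 : ℝ) < n := by exact_mod_cast hn
  rcases le_or_gt ((n + 1 : ℝ) / n) ‖z‖ with hr | hr
  · refine le_trans ?_ (h _ hr)
    have h1 : ((‖z‖ : ℝ) : ℂ) ≠ 1 := by exact_mod_cast (hr1.trans_le hr).ne'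
    exact (logFactor_le_iff n hz h1).2 (norm_primaryFactor_le_ofReal hn hr rfl)
  · refine (logFactor_le_div hn hz).trans ?_
    have h2 : n / (n + 1 : ℝ) * ‖z‖ ≤ 1 := by
      rw [lt_div_iff₀ hn0] at hr
      rw [div_mul_eq_mul_div, div_le_one (by positivity)]
      linarith
    have h3 : 0 ≤ ‖z‖ ^ n := by positivity
    rw [pow_succ]
    nlinarith

lemma logFactor_le_pow (hn : 2 ≤ n) {z : ℂ} (hz : z ≠ 1) : logFactor n z ≤ ‖z‖ ^ n := by
  have hn1 : 1 ≤ n := by omega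
  have := logFactor_le_mul_pow hn1 le_rfl (fun x hx => by
    rw [one_mul]
    exact logFactor_ofReal_le_pow hn ((one_lt_succ_div hn1).trans_le hx)) hz
  rwa [one_mul] at this

lemma lambertW_exp_neg_one :
    lambertW (Real.exp (-1)) * Real.exp (lambertW (Real.exp (-1))) = Real.exp (-1) := by
  have hex : ∃ a ∈ Set.Ici (-1 : ℝ), (fun x : ℝ => x * Real.exp x) a = Real.exp (-1) := by
    have hcont : ContinuousOn (fun x : ℝ => x * Real.exp x) (Set.Icc 0 1) := by fun_prop
    obtain ⟨a, ha, h⟩ := intermediate_value_Icc zero_le_one hcont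
      (show Real.exp (-1) ∈ Set.Icc _ _ from
        ⟨by simpa using (Real.exp_pos _).le, by simp⟩)
    exact ⟨a, by simp only [Set.mem_Ici]; linarith [ha.1], h⟩
  exact Function.invFunOn_eq hex

lemma lambertW_exp_neg_one_pos : 0 < lambertW (Real.exp (-1)) := by
  have h := lambertW_exp_neg_one
  by_contra hcon
  have := mul_nonpos_of_nonpos_of_nonneg (not_lt.1 hcon)
    (Real.exp_pos (lambertW (Real.exp (-1)))).le
  linarith [Real.exp_pos (-1)]

/-- With `W = W(1/e)`, the tangent line bound `ln (W (x - 1)) ≤ W (x - 1) - 1` is the bound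
`ln (x - 1) ≤ W x`. -/
lemma logFactor_one_le {z : ℂ} (hz : z ≠ 1) :
    logFactor 1 z ≤ (1 + lambertW (Real.exp (-1))) * ‖z‖ := by
  have hW := lambertW_exp_neg_one
  have hpos := lambertW_exp_neg_one_pos
  set w := lambertW (Real.exp (-1))
  have hlog : Real.log w = -1 - w := by
    have := congrArg Real.log hW
    rw [Real.log_mul hpos.ne' (Real.exp_ne_zero _), Real.log_exp, Real.log_exp] at this
    linarith
  have := logFactor_le_mul_pow le_rfl (K := 1 + w) (by linarith) (fun x hx => by
    have hx1 : 1 < x := (one_lt_succ_div le_rfl).trans_le hx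
    rw [logFactor_ofReal 1 hx1.ne', abs_of_pos (by linarith)]
    have h1 := Real.log_le_sub_one_of_pos (mul_pos hpos (sub_pos.2 hx1))
    rw [Real.log_mul hpos.ne' (sub_pos.2 hx1).ne', hlog] at h1
    simp only [Finset.Icc_self, Finset.sum_singleton, pow_one, Nat.cast_one, div_one]
    linarith) hz
  rwa [pow_one] at this

end

/-! ### The exponential integral -/

lemma integrableOn_exp_div_Iic {a : ℝ} (ha : a < 0) :
    MeasureTheory.IntegrableOn (fun t : ℝ => Real.exp t / t) (Set.Iic a) := by
  have h := (integrableOn_exp_Iic a).div_const (-a)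
  refine MeasureTheory.Integrable.mono h ?_ ?_
  · refine (ContinuousOn.div Real.continuous_exp.continuousOn continuousOn_id
      fun t ht => ?_).aestronglyMeasurable measurableSet_Iic
    exact (lt_of_le_of_lt ht ha).ne
  · refine (MeasureTheory.ae_restrict_iff' measurableSet_Iic).2 (Eventually.of_forall fun t ht => ?_)
    have ht' : t ≤ a := ht
    have h1 : |t| = -t := abs_of_neg (by linarith)
    rw [norm_div, norm_div, Real.norm_eq_abs t, Real.norm_eq_abs (-a), h1,
      abs_of_pos (by linarith : 0 < -a)]
    exact div_le_div_of_nonneg_left (norm_nonneg _) (by linarith) (by linarith)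

/-- The integral `∫_{-∞}^a e^t / t dt`, that is `Ei(a)`, for `a < 0`. -/
noncomputable def expIntegralNeg (a : ℝ) : ℝ := ∫ t in Set.Iic a, Real.exp t / t

lemma intervalIntegrable_exp_div {a b : ℝ} (h : 0 ∉ Set.uIcc a b) :
    IntervalIntegrable (fun t : ℝ => Real.exp t / t) MeasureTheory.volume a b := by
  refine ContinuousOn.intervalIntegrable (ContinuousOn.div Real.continuous_exp.continuousOn
    continuousOn_id fun t ht => ?_)
  rintro rfl
  exact h ht

lemma hasDerivAt_integral_exp_div {a b : ℝ} (h : 0 ∉ Set.uIcc a b) :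
    HasDerivAt (fun x => ∫ t in a..x, Real.exp t / t) (Real.exp b / b) b := by
  have hb : b ≠ 0 := by
    rintro rfl
    exact h Set.right_mem_uIcc
  refine intervalIntegral.integral_hasDerivAt_right (intervalIntegrable_exp_div h)
    (Measurable.stronglyMeasurable (by fun_prop)).stronglyMeasurableAtFilter ?_
  exact Real.continuous_exp.continuousAt.div continuousAt_id hb

lemma expIntegralNeg_eq {a : ℝ} (ha : a < 0) :
    expIntegralNeg a = expIntegralNeg (-1) + ∫ t in (-1)..a, Real.exp t / t := by
  have := intervalIntegral.integral_Iic_sub_Iic (integrableOn_exp_div_Iic (by norm_num : (-1 : ℝ) < 0))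
    (integrableOn_exp_div_Iic ha)
  rw [← this, expIntegralNeg, expIntegralNeg]
  ring

lemma hasDerivAt_expIntegralNeg {a : ℝ} (ha : a < 0) :
    HasDerivAt expIntegralNeg (Real.exp a / a) a := by
  have h0 : (0 : ℝ) ∉ Set.uIcc (-1) a := fun h => by
    have := h.2.trans_lt (max_lt (by norm_num : (-1 : ℝ) < 0) ha)
    exact lt_irrefl _ this
  refine ((hasDerivAt_integral_exp_div h0).const_add
    (expIntegralNeg (-1))).congr_of_eventuallyEq ?_
  filter_upwards [Iio_mem_nhds ha] with x hx using expIntegralNeg_eq hx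

lemma neg_exp_div_le_expIntegralNeg {m : ℝ} (hm : 0 < m) :
    -(Real.exp (-m) / m) ≤ expIntegralNeg (-m) := by
  have h1 : ∫ t in Set.Iic (-m), -(Real.exp t / m) = -(Real.exp (-m) / m) := by
    rw [MeasureTheory.integral_neg, MeasureTheory.integral_div, integral_exp_Iic]
  rw [← h1, expIntegralNeg]
  refine MeasureTheory.setIntegral_mono_on ((integrableOn_exp_Iic _).div_const _).neg
    (integrableOn_exp_div_Iic (by linarith)) measurableSet_Iic fun t ht => ?_
  have ht' : t ≤ -m := ht
  rw [← neg_div_neg_eq (Real.exp t) t, neg_div]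
  exact neg_le_neg (div_le_div_of_nonneg_left (Real.exp_pos t).le hm (by linarith))

lemma zero_notMem_uIcc {a b : ℝ} (ha : 0 < a) (hb : 0 < b) : (0 : ℝ) ∉ Set.uIcc a b := fun h =>
  lt_irrefl _ ((lt_min ha hb).trans_le h.1)

/-- The singular parts of `e^t / t` on the two sides of `0` cancel. -/
lemma exists_tendsto_expIntegralNeg : ∃ K : ℝ, Tendsto
    (fun ε => expIntegralNeg (-ε) - ∫ t in (1 : ℝ)..ε, Real.exp t / t) (𝓝[>] 0) (𝓝 K) := by
  have hdiff : Differentiable ℝ (fun t : ℝ => Real.exp t - Real.exp (-t)) := by fun_prop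
  have hcont : Continuous (dslope (fun t : ℝ => Real.exp t - Real.exp (-t)) 0) :=
    continuous_iff_continuousAt.2 fun t => by
      rcases eq_or_ne t 0 with rfl | ht
      · exact continuousAt_dslope_same.2 (hdiff 0)
      · exact (continuousAt_dslope_of_ne ht).2 (hdiff t).continuousAt
  set h := dslope (fun t : ℝ => Real.exp t - Real.exp (-t)) 0 with hh
  have hval : ∀ t : ℝ, t ≠ 0 → h t = Real.exp t / t - Real.exp (-t) / t := fun t ht => by
    rw [hh, dslope_of_ne _ ht, slope_def_field]
    simp [sub_div]
  refine ⟨expIntegralNeg (-1) + ∫ t in (0 : ℝ)..1, h t, ?_⟩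
  have hprim : Tendsto (fun ε => expIntegralNeg (-1) + ∫ t in ε..1, h t) (𝓝[>] 0)
      (𝓝 (expIntegralNeg (-1) + ∫ t in (0 : ℝ)..1, h t)) := by
    have hd := intervalIntegral.integral_hasDerivAt_left (hcont.intervalIntegrable 0 1)
      hcont.stronglyMeasurable.stronglyMeasurableAtFilter hcont.continuousAt
    exact tendsto_const_nhds.add (hd.continuousAt.tendsto.mono_left nhdsWithin_le_nhds)
  refine hprim.congr' ?_
  filter_upwards [self_mem_nhdsWithin] with ε hε
  have hε' : 0 < ε := hε
  have h0 := zero_notMem_uIcc hε' one_pos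
  have hneg : ∫ t in (-1 : ℝ)..(-ε), Real.exp t / t = - ∫ t in ε..1, Real.exp (-t) / t := by
    rw [← intervalIntegral.integral_comp_neg (fun t => Real.exp t / t),
      ← intervalIntegral.integral_neg]
    refine intervalIntegral.integral_congr fun t _ => ?_
    simp only [div_neg]
  have hint : IntervalIntegrable (fun t : ℝ => Real.exp (-t) / t) MeasureTheory.volume ε 1 := by
    refine ContinuousOn.intervalIntegrable (ContinuousOn.div (by fun_prop)
      continuousOn_id fun t ht => ?_)
    rintro rfl
    exact h0 ht
  rw [expIntegralNeg_eq (neg_lt_zero.2 hε'), hneg, intervalIntegral.integral_symm ε 1,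
    sub_neg_eq_add, intervalIntegral.integral_congr (g := fun t => Real.exp t / t - Real.exp (-t) / t)
      (fun t ht => hval t (by rintro rfl; exact h0 ht)),
    intervalIntegral.integral_sub (intervalIntegrable_exp_div h0) hint]
  ring

lemma setIntegral_exp_div_eq {x ε : ℝ} (hε : 0 < ε) (hx : ε < x) :
    ∫ t in {t : ℝ | t ≤ x ∧ ε < |t|}, Real.exp t / t =
      expIntegralNeg (-ε) + ∫ t in ε..x, Real.exp t / t := by
  have hset : {t : ℝ | t ≤ x ∧ ε < |t|} = Set.Iio (-ε) ∪ Set.Ioc ε x := by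
    ext t
    simp only [Set.mem_ofPred_eq, Set.mem_union, Set.mem_Iio, Set.mem_Ioc, lt_abs]
    constructor
    · rintro ⟨h1, h2 | h2⟩
      · exact Or.inr ⟨h2, h1⟩
      · exact Or.inl (by linarith)
    · rintro (h | ⟨h1, h2⟩)
      · exact ⟨by linarith, Or.inr (by linarith)⟩
      · exact ⟨h2, Or.inl h1⟩
  have hdisj : Disjoint (Set.Iio (-ε)) (Set.Ioc ε x) :=
    Set.disjoint_left.2 fun t h1 h2 => by
      have := Set.mem_Iio.1 h1
      linarith [h2.1]
  rw [hset, MeasureTheory.setIntegral_union hdisj measurableSet_Ioc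
    ((integrableOn_exp_div_Iic (by linarith)).mono_set Set.Iio_subset_Iic_self)
    ((intervalIntegrable_exp_div (zero_notMem_uIcc hε (hε.trans hx))).1),
    intervalIntegral.integral_of_le hx.le, expIntegralNeg, MeasureTheory.integral_Iic_eq_integral_Iio]

/-- On `(0, ∞)` the exponential integral is an antiderivative of `e^x / x`, with the constant fixed by
the requirement that its values at `± ε` agree in the limit. -/
lemma exists_expIntegralEi_eq : ∃ K : ℝ,
    (∀ x : ℝ, 0 < x → expIntegralEi x = K + ∫ t in (1 : ℝ)..x, Real.exp t / t) ∧
      Tendsto (fun ε => expIntegralNeg (-ε) - expIntegralEi ε) (𝓝[>] 0) (𝓝 0) := by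
  obtain ⟨K, hK⟩ := exists_tendsto_expIntegralNeg
  have hEi : ∀ x : ℝ, 0 < x → expIntegralEi x = K + ∫ t in (1 : ℝ)..x, Real.exp t / t := by
    intro x hx
    refine Tendsto.limUnder_eq ?_
    refine (hK.add_const (∫ t in (1 : ℝ)..x, Real.exp t / t)).congr' ?_
    filter_upwards [Ioo_mem_nhdsGT hx] with ε hε
    have hadd := intervalIntegral.integral_add_adjacent_intervals
      (intervalIntegrable_exp_div (zero_notMem_uIcc one_pos hε.1))
      (intervalIntegrable_exp_div (zero_notMem_uIcc hε.1 hx))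
    rw [setIntegral_exp_div_eq hε.1 hε.2, ← hadd]
    ring
  refine ⟨K, hEi, ?_⟩
  have := hK.sub_const K
  rw [sub_self] at this
  refine this.congr' ?_
  filter_upwards [self_mem_nhdsWithin] with ε hε
  rw [hEi ε hε]
  ring

lemma hasDerivAt_expIntegralEi {x : ℝ} (hx : 0 < x) :
    HasDerivAt expIntegralEi (Real.exp x / x) x := by
  obtain ⟨K, hK, -⟩ := exists_expIntegralEi_eq
  refine ((hasDerivAt_integral_exp_div (zero_notMem_uIcc one_pos hx)).const_add
    K).congr_of_eventuallyEq ?_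
  filter_upwards [Ioi_mem_nhds hx] with y hy using hK y hy

lemma hasDerivAt_exp_div_sub_expIntegralEi {x : ℝ} (hx : 0 < x) :
    HasDerivAt (fun x => Real.exp x / x - expIntegralEi x) (-(Real.exp x / x ^ 2)) x := by
  refine (((Real.hasDerivAt_exp x).div (hasDerivAt_id x) hx.ne').sub
    (hasDerivAt_expIntegralEi hx)).congr_deriv ?_
  simp only [id]
  field_simp
  ring

lemma exists_unique_zero_exp_div_sub_expIntegralEi :
    ∃ x₀ : ℝ, 0 < x₀ ∧ Real.exp x₀ / x₀ - expIntegralEi x₀ = 0 ∧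
      ∀ x : ℝ, 0 < x → Real.exp x / x - expIntegralEi x = 0 → x = x₀ := by
  set f : ℝ → ℝ := fun x => Real.exp x / x - expIntegralEi x with hf
  have hd : ∀ x, 0 < x → HasDerivAt f (-(Real.exp x / x ^ 2)) x := fun x hx =>
    hasDerivAt_exp_div_sub_expIntegralEi hx
  have hanti : StrictAntiOn f (Set.Ioi 0) := by
    refine strictAntiOn_of_deriv_neg (convex_Ioi 0)
      (fun x hx => (hd x hx).continuousAt.continuousWithinAt) fun x hx => ?_
    have hx' : 0 < x := interior_subset hx
    rw [(hd x hx').deriv]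
    exact neg_neg_of_pos (by positivity)
  -- near `0` the term `1 / x` wins
  obtain ⟨a, ha0, ha1, hfa⟩ : ∃ a : ℝ, 0 < a ∧ a ≤ 1 ∧ 0 ≤ f a := by
    have hpos : 0 < |expIntegralEi 1| + 1 := by positivity
    refine ⟨(|expIntegralEi 1| + 1)⁻¹, by positivity,
      inv_le_one_of_one_le₀ (by linarith [abs_nonneg (expIntegralEi 1)]), ?_⟩
    have ha0 : 0 < (|expIntegralEi 1| + 1)⁻¹ := by positivity
    have ha1 : (|expIntegralEi 1| + 1)⁻¹ ≤ 1 :=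
      inv_le_one_of_one_le₀ (by linarith [abs_nonneg (expIntegralEi 1)])
    have hmono : expIntegralEi (|expIntegralEi 1| + 1)⁻¹ ≤ expIntegralEi 1 := by
      have hm : MonotoneOn expIntegralEi (Set.Ioi 0) := monotoneOn_of_deriv_nonneg (convex_Ioi 0)
        (fun x hx => (hasDerivAt_expIntegralEi hx).continuousAt.continuousWithinAt)
        (fun x hx => (hasDerivAt_expIntegralEi
          (interior_subset hx)).differentiableAt.differentiableWithinAt)
        (fun x hx => by
          have hx' : 0 < x := interior_subset hx
          rw [(hasDerivAt_expIntegralEi hx').deriv]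
          positivity)
      exact hm ha0 (Set.mem_Ioi.2 one_pos) ha1
    have hexp : 1 ≤ Real.exp (|expIntegralEi 1| + 1)⁻¹ := Real.one_le_exp ha0.le
    have : |expIntegralEi 1| + 1 ≤
        Real.exp (|expIntegralEi 1| + 1)⁻¹ / (|expIntegralEi 1| + 1)⁻¹ := by
      rw [div_inv_eq_mul]
      nlinarith
    simp only [hf]
    linarith [le_abs_self (expIntegralEi 1)]
  -- the slope of `f` is at most `- 1 / 2` on `[1, ∞)`
  obtain ⟨b, hb1, hfb⟩ : ∃ b : ℝ, 1 ≤ b ∧ f b ≤ 0 := by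
    refine ⟨1 + 2 * |f 1|, by linarith [abs_nonneg (f 1)], ?_⟩
    have hle : (1 : ℝ) ≤ 1 + 2 * |f 1| := by linarith [abs_nonneg (f 1)]
    have hd' : ∀ x ∈ Set.Ici (1 : ℝ), HasDerivAt (fun x => f x + x / 2)
        (-(Real.exp x / x ^ 2) + 1 / 2) x := fun x hx =>
      (hd x (one_pos.trans_le hx)).add ((hasDerivAt_id x).div_const 2)
    have hanti' := antitoneOn_of_deriv_nonpos (convex_Ici (1 : ℝ))
      (fun x hx => (hd' x hx).continuousAt.continuousWithinAt)
      (fun x hx => (hd' x (interior_subset hx)).differentiableAt.differentiableWithinAt)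
      (fun x hx => by
        have hx' : 1 ≤ x := interior_subset hx
        rw [(hd' x hx').deriv]
        have h1 := Real.quadratic_le_exp_of_nonneg (by linarith : 0 ≤ x)
        have h2 : 1 / 2 ≤ Real.exp x / x ^ 2 := by
          rw [le_div_iff₀ (by positivity)]
          linarith
        linarith) (Set.self_mem_Ici) (show 1 + 2 * |f 1| ∈ Set.Ici (1 : ℝ) from hle) hle
    simp only at hanti'
    linarith [le_abs_self (f 1)]
  obtain ⟨x₀, hx₀, hzero⟩ := intermediate_value_Icc' (ha1.trans hb1)
    (fun x hx => (hd x (ha0.trans_le hx.1)).continuousAt.continuousWithinAt)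
    (show (0 : ℝ) ∈ Set.Icc (f b) (f a) from ⟨hfb, hfa⟩)
  have h0 : 0 < x₀ := ha0.trans_le hx₀.1
  exact ⟨x₀, h0, hzero, fun x hx h => hanti.injOn hx h0 (h.trans hzero.symm)⟩

section
variable (n : ℕ)

/-- The remainder `(e^t - (1 + t / m)^m) / t` for `m = n + 1`. -/
noncomputable def expRemainder (t : ℝ) : ℝ :=
  (Real.exp t - (1 + t / (n + 1)) ^ (n + 1)) / t

lemma hasDerivAt_expRemainder {t : ℝ} (ht : t ≠ 0) :
    HasDerivAt (expRemainder n) ((Real.exp t - (1 + t / (n + 1)) ^ n) / t -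
      (Real.exp t - (1 + t / (n + 1)) ^ (n + 1)) / t ^ 2) t := by
  have h1 : HasDerivAt (fun t : ℝ => 1 + t / (n + 1 : ℝ)) (1 / (n + 1 : ℝ)) t :=
    ((hasDerivAt_id t).div_const _).const_add 1
  refine (((Real.hasDerivAt_exp t).sub (h1.pow (n + 1))).div (hasDerivAt_id t) ht).congr_deriv ?_
  rw [Nat.add_sub_cancel]
  simp only [Pi.sub_apply, Pi.pow_apply, id]
  push_cast
  field_simp

lemma tendsto_expRemainder : Tendsto (expRemainder n) (𝓝[≠] 0) (𝓝 0) := by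
  have h1 : HasDerivAt (fun t : ℝ => 1 + t / (n + 1 : ℝ)) (1 / (n + 1 : ℝ)) 0 :=
    ((hasDerivAt_id 0).div_const _).const_add 1
  have h2 := (Real.hasDerivAt_exp 0).sub (h1.pow (n + 1))
  have h3 : HasDerivAt (Real.exp - (fun t : ℝ => 1 + t / (n + 1 : ℝ)) ^ (n + 1)) 0 0 := by
    refine h2.congr_deriv ?_
    push_cast
    simp
    field_simp
    simp
  refine h3.tendsto_slope.congr fun t => ?_
  rw [slope_def_field, expRemainder]
  simp

lemma hasDerivAt_logFactor_one_add {t : ℝ} (ht : t ≠ 0) :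
    HasDerivAt (fun t : ℝ => logFactor n ((1 + t / (n + 1) : ℝ) : ℂ))
      ((1 + t / (n + 1)) ^ n / t) t := by
  have hm : (n + 1 : ℝ) ≠ 0 := by positivity
  have h1 : HasDerivAt (fun t : ℝ => 1 + t / (n + 1 : ℝ)) (1 / (n + 1 : ℝ)) t :=
    ((hasDerivAt_id t).div_const _).const_add 1
  have hne : 1 + t / (n + 1 : ℝ) ≠ 1 := by simpa using ⟨ht, hm⟩
  refine (HasDerivAt.comp t (hasDerivAt_logFactor_ofReal n hne) h1).congr_deriv ?_
  rw [add_sub_cancel_left]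
  field_simp

lemma one_add_div_pow_le_exp {t : ℝ} (ht : -(n + 1 : ℝ) ≤ t) :
    (1 + t / (n + 1)) ^ (n + 1) ≤ Real.exp t := by
  have := Real.one_sub_div_pow_le_exp_neg (n := n + 1) (t := -t) (by push_cast; linarith)
  rw [neg_neg] at this
  push_cast at this
  rwa [neg_div, sub_neg_eq_add] at this

/-- The logarithmic singularity of `ln |E_n|` at `1` is the same on both sides. -/
lemma tendsto_logFactor_one_add_sub : Tendsto
    (fun ε : ℝ => logFactor n ((1 + ε / (n + 1) : ℝ) : ℂ) -
      logFactor n ((1 + -ε / (n + 1) : ℝ) : ℂ)) (𝓝[>] 0) (𝓝 0) := by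
  have hm : (n + 1 : ℝ) ≠ 0 := by positivity
  have hcont : Continuous fun ε : ℝ => ∑ k ∈ Finset.Icc 1 n, (1 + ε / (n + 1)) ^ k / (k : ℝ) -
      ∑ k ∈ Finset.Icc 1 n, (1 + -ε / (n + 1)) ^ k / (k : ℝ) := by fun_prop
  have h0 := (hcont.tendsto 0).mono_left (nhdsWithin_le_nhds (s := Set.Ioi 0))
  simp only [neg_zero, sub_self] at h0
  refine h0.congr' ?_
  filter_upwards [self_mem_nhdsWithin] with ε hε
  have hε' : ε ≠ 0 := (Set.mem_Ioi.1 hε).ne'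
  have h1 : 1 + ε / (n + 1 : ℝ) ≠ 1 := by simpa using ⟨hε', hm⟩
  have h2 : 1 + -ε / (n + 1 : ℝ) ≠ 1 := by simpa using ⟨hε', hm⟩
  rw [logFactor_ofReal n h1, logFactor_ofReal n h2, add_sub_cancel_left, add_sub_cancel_left,
    neg_div, abs_neg]
  ring

/-- The functions `ln |E_n(1 + t / m)|`, with `m = n + 1`, and `Ei(t)` have the derivatives
`(1 + t / m)^n / t` and `e^t / t`. The difference
`Ei(t) - ln |E_n(1 + t / m)| - (e^t - (1 + t / m)^m) / t` is nonnegative at `t = -m`, nondecreasing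
on `[-m, 0)` and on `(0, ∞)`, and its singularity at `0` is removable. -/
lemma logFactor_one_add_le_expIntegralEi {x : ℝ} (hx : 0 < x) :
    logFactor n ((1 + x / (n + 1) : ℝ) : ℂ) + expRemainder n x ≤ expIntegralEi x := by
  have hm : (0 : ℝ) < n + 1 := by positivity
  have hsign : ∀ t : ℝ, -(n + 1 : ℝ) ≤ t →
      0 ≤ (Real.exp t - (1 + t / (n + 1)) ^ (n + 1)) / t ^ 2 := fun t ht =>
    div_nonneg (sub_nonneg.2 (one_add_div_pow_le_exp n ht)) (sq_nonneg t)
  have hdiff : ∀ {F : ℝ → ℝ} {t : ℝ}, t ≠ 0 → HasDerivAt F (Real.exp t / t) t →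
      HasDerivAt (fun t => F t - logFactor n ((1 + t / (n + 1) : ℝ) : ℂ) - expRemainder n t)
        ((Real.exp t - (1 + t / (n + 1)) ^ (n + 1)) / t ^ 2) t := fun ht hF => by
    refine ((hF.sub (hasDerivAt_logFactor_one_add n ht)).sub
      (hasDerivAt_expRemainder n ht)).congr_deriv ?_
    ring
  have hnegd : ∀ t ∈ Set.Ico (-(n + 1 : ℝ)) 0, HasDerivAt (fun t => expIntegralNeg t -
      logFactor n ((1 + t / (n + 1) : ℝ) : ℂ) - expRemainder n t)
        ((Real.exp t - (1 + t / (n + 1)) ^ (n + 1)) / t ^ 2) t := fun t ht =>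
    hdiff ht.2.ne (hasDerivAt_expIntegralNeg ht.2)
  have hposd : ∀ t ∈ Set.Ioi (0 : ℝ), HasDerivAt (fun t => expIntegralEi t -
      logFactor n ((1 + t / (n + 1) : ℝ) : ℂ) - expRemainder n t)
        ((Real.exp t - (1 + t / (n + 1)) ^ (n + 1)) / t ^ 2) t := fun t ht =>
    hdiff (Set.mem_Ioi.1 ht).ne' (hasDerivAt_expIntegralEi ht)
  have hnegmono := monotoneOn_of_deriv_nonneg (convex_Ico (-(n + 1 : ℝ)) 0)
    (fun t ht => (hnegd t ht).continuousAt.continuousWithinAt)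
    (fun t ht => (hnegd t (interior_subset ht)).differentiableAt.differentiableWithinAt)
    (fun t ht => by
      rw [(hnegd t (interior_subset ht)).deriv]
      exact hsign t (interior_subset ht).1)
  have hposmono := monotoneOn_of_deriv_nonneg (convex_Ioi (0 : ℝ))
    (fun t ht => (hposd t ht).continuousAt.continuousWithinAt)
    (fun t ht => (hposd t (interior_subset ht)).differentiableAt.differentiableWithinAt)
    (fun t ht => by
      have ht' : 0 < t := interior_subset ht
      rw [(hposd t ht').deriv]
      exact hsign t (by linarith))
  have hstart : 0 ≤ expIntegralNeg (-(n + 1 : ℝ)) -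
      logFactor n ((1 + -(n + 1 : ℝ) / (n + 1) : ℝ) : ℂ) - expRemainder n (-(n + 1 : ℝ)) := by
    have h0 : 1 + -(n + 1 : ℝ) / (n + 1) = 0 := by field_simp; ring
    have h1 := neg_exp_div_le_expIntegralNeg hm
    rw [expRemainder, h0, zero_pow (by omega), Complex.ofReal_zero, logFactor_zero, sub_zero,
      sub_zero, div_neg]
    linarith
  -- the jump of the difference across `0` vanishes
  have hlim : Tendsto (fun ε : ℝ => (expIntegralNeg (-ε) - expIntegralEi ε) +
      (logFactor n ((1 + ε / (n + 1) : ℝ) : ℂ) - logFactor n ((1 + -ε / (n + 1) : ℝ) : ℂ)) +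
      (expRemainder n ε - expRemainder n (-ε))) (𝓝[>] 0) (𝓝 0) := by
    obtain ⟨K, -, hK⟩ := exists_expIntegralEi_eq
    have hR1 := (tendsto_expRemainder n).mono_left
      (nhdsWithin_mono 0 (fun x (hx : 0 < x) => hx.ne') : 𝓝[>] (0 : ℝ) ≤ 𝓝[≠] 0)
    have hneg : Tendsto (fun ε : ℝ => -ε) (𝓝[>] 0) (𝓝[≠] 0) := by
      refine tendsto_nhdsWithin_iff.2 ⟨?_, ?_⟩
      · simpa using (continuous_neg.tendsto (0 : ℝ)).mono_left (nhdsWithin_le_nhds (s := Set.Ioi 0))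
      · filter_upwards [self_mem_nhdsWithin] with ε hε
        exact neg_ne_zero.2 (Set.mem_Ioi.1 hε).ne'
    have hR2 := (tendsto_expRemainder n).comp hneg
    simpa using (hK.add (tendsto_logFactor_one_add_sub n)).add (hR1.sub hR2)
  have key : -(expIntegralEi x - logFactor n ((1 + x / (n + 1) : ℝ) : ℂ) - expRemainder n x) ≤ 0 := by
    refine ge_of_tendsto hlim ?_
    filter_upwards [Ioo_mem_nhdsGT hx, Ioo_mem_nhdsGT hm] with ε hεx hεm
    have h1 := hposmono (show ε ∈ Set.Ioi 0 from hεx.1) (show x ∈ Set.Ioi 0 from hx) hεx.2.le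
    have h2 := hnegmono (show -(n + 1 : ℝ) ∈ Set.Ico (-(n + 1 : ℝ)) 0 from ⟨le_rfl, by linarith⟩)
      (show -ε ∈ Set.Ico (-(n + 1 : ℝ)) 0 from ⟨by linarith [hεm.2], by linarith [hεx.1]⟩)
      (by linarith [hεm.2])
    simp only at h1 h2
    linarith
  linarith

end

/-! ### The growth constants -/

section
variable {n : ℕ} {α : ℝ}

lemma logFactor_le_pow_div {x₀ : ℝ} (hx₀ : 0 < x₀)
    (hzero : Real.exp x₀ / x₀ - expIntegralEi x₀ = 0) (hn : 1 ≤ n) {z : ℂ} (hz : z ≠ 1) :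
    logFactor n z ≤ x₀⁻¹ * ‖z‖ ^ (n + 1) := by
  have hm : (0 : ℝ) < n + 1 := by positivity
  refine logFactor_le_of_forall_ofReal_le hn (fun x hx => ?_) hz
  have hx1 := (one_lt_succ_div hn).trans_le hx
  have hfac : ∀ t : ℝ, 1 < t → x₀⁻¹ * ((n + 1 : ℝ) * t ^ n) - t ^ n / (t - 1) =
      t ^ n * ((n + 1) * (t - 1) - x₀) / (x₀ * (t - 1)) := fun t ht => by
    have h1 : t - 1 ≠ 0 := by linarith
    field_simp
  have hle : ∀ t : ℝ, t ≤ 1 + x₀ / (n + 1) ↔ (n + 1) * (t - 1) - x₀ ≤ 0 := fun t => by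
    rw [← sub_le_iff_le_add', le_div_iff₀ hm, sub_nonpos, mul_comm]
  have hge : ∀ t : ℝ, 1 + x₀ / (n + 1) ≤ t ↔ 0 ≤ (n + 1) * (t - 1) - x₀ := fun t => by
    rw [← le_sub_iff_add_le', div_le_iff₀ hm, sub_nonneg, mul_comm]
  have key : 0 ≤ x₀⁻¹ * x ^ (n + 1) - logFactor n (x : ℂ) := by
    refine nonneg_of_deriv_sign (f := fun x : ℝ => x₀⁻¹ * x ^ (n + 1) - logFactor n (x : ℂ))
      (f' := fun t => x₀⁻¹ * ((n + 1 : ℝ) * t ^ n) - t ^ n / (t - 1)) (a := 1)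
      (c := 1 + x₀ / (n + 1)) (by simpa using div_pos hx₀ hm) (fun t ht => ?_)
      (fun t ht htc => ?_) (fun t htc => ?_) ?_ hx1
    · have h1 := ((hasDerivAt_pow (n + 1) t).const_mul x₀⁻¹).sub
        (hasDerivAt_logFactor_ofReal n ht.ne')
      rw [Nat.add_sub_cancel] at h1
      push_cast at h1
      exact h1
    · rw [hfac t ht]
      exact div_nonpos_of_nonpos_of_nonneg (mul_nonpos_of_nonneg_of_nonpos
        (pow_nonneg (by linarith) _) ((hle t).1 htc)) (mul_nonneg hx₀.le (by linarith))
    · have ht : 1 < t := lt_of_lt_of_le (by simpa using div_pos hx₀ hm) htc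
      rw [hfac t ht]
      exact div_nonneg (mul_nonneg (pow_nonneg (by linarith) _) ((hge t).1 htc))
        (mul_nonneg hx₀.le (by linarith))
    · have h1 := logFactor_one_add_le_expIntegralEi n hx₀
      rw [expRemainder, sub_div] at h1
      rw [inv_mul_eq_div]
      linarith
  linarith

lemma growthQuotient_eq (n : ℕ) (α : ℝ) (z : ℂ) :
    growthQuotient n α z = logFactor n z / ‖z‖ ^ ((n : ℝ) + α) := rfl

lemma ne_of_mem_compl {z : ℂ} (hz : z ∈ ({0, 1}ᶜ : Set ℂ)) : z ≠ 0 ∧ z ≠ 1 := by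
  simpa using hz

lemma mem_upperBounds_growthValues {C : ℝ}
    (h : ∀ z : ℂ, z ≠ 0 → z ≠ 1 → logFactor n z ≤ C * ‖z‖ ^ ((n : ℝ) + α)) :
    C ∈ upperBounds (growthValues n α) := by
  rintro _ ⟨z, hz, rfl⟩
  obtain ⟨h0, h1⟩ := ne_of_mem_compl hz
  rw [growthQuotient_eq, div_le_iff₀ (Real.rpow_pos_of_pos (norm_pos_iff.2 h0) _)]
  exact h z h0 h1

lemma growthConst_le {C : ℝ}
    (h : ∀ z : ℂ, z ≠ 0 → z ≠ 1 → logFactor n z ≤ C * ‖z‖ ^ ((n : ℝ) + α)) :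
    growthConst n α ≤ C := by
  refine csSup_le ⟨_, 2, ?_, rfl⟩ (mem_upperBounds_growthValues h)
  simp

/-- The reason is `r^{n+α} ≥ min(r^n, r^{n+1})`. -/
lemma le_rpow_of_le_pow {K r l : ℝ} (hα0 : 0 ≤ α) (hα1 : α ≤ 1) (hK : 0 ≤ K) (hr : 0 < r)
    (h0 : l ≤ K * r ^ n) (h1 : l ≤ K * r ^ (n + 1)) : l ≤ K * r ^ ((n : ℝ) + α) := by
  rcases le_total r 1 with h | h
  · refine h1.trans (mul_le_mul_of_nonneg_left ?_ hK)
    rw [← Real.rpow_natCast]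
    push_cast
    exact Real.rpow_le_rpow_of_exponent_ge hr h (by linarith)
  · refine h0.trans (mul_le_mul_of_nonneg_left ?_ hK)
    rw [← Real.rpow_natCast]
    exact Real.rpow_le_rpow_of_exponent_le h (by linarith)

lemma bddAbove_growthValues (hn : 1 ≤ n) (hα0 : 0 ≤ α) (hα1 : α ≤ 1) :
    BddAbove (growthValues n α) := by
  obtain ⟨K, hK, h0⟩ : ∃ K : ℝ, 1 ≤ K ∧ ∀ z : ℂ, z ≠ 1 → logFactor n z ≤ K * ‖z‖ ^ n := by
    rcases hn.eq_or_lt with rfl | hn2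
    · exact ⟨_, le_add_of_nonneg_right lambertW_exp_neg_one_pos.le,
        fun z hz => by rw [pow_one]; exact logFactor_one_le hz⟩
    · exact ⟨1, le_rfl, fun z hz => by rw [one_mul]; exact logFactor_le_pow hn2 hz⟩
  refine ⟨K, mem_upperBounds_growthValues fun z hz0 hz1 =>
    le_rpow_of_le_pow hα0 hα1 (by linarith) (norm_pos_iff.2 hz0) (h0 z hz1) ?_⟩
  refine (logFactor_le_div hn hz1).trans (mul_le_mul_of_nonneg_right ?_ (by positivity))
  exact (div_le_one_of_le₀ (by linarith) (by positivity)).trans hK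

lemma logFactor_le_growthConst_mul (hn : 1 ≤ n) (hα0 : 0 ≤ α) (hα1 : α ≤ 1) {z : ℂ}
    (hz0 : z ≠ 0) (hz1 : z ≠ 1) : logFactor n z ≤ growthConst n α * ‖z‖ ^ ((n : ℝ) + α) := by
  rw [← div_le_iff₀ (Real.rpow_pos_of_pos (norm_pos_iff.2 hz0) _), ← growthQuotient_eq]
  exact le_csSup (bddAbove_growthValues hn hα0 hα1) ⟨z, by simp [hz0, hz1], rfl⟩

lemma growthConst_nonneg (hn : 1 ≤ n) (hα0 : 0 ≤ α) (hα1 : α ≤ 1) : 0 ≤ growthConst n α := by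
  have h := logFactor_le_growthConst_mul hn hα0 hα1 (z := 2) (by norm_num) (by norm_num)
  have h2 : 0 ≤ logFactor n 2 := by
    have := logFactor_ofReal n (x := 2) (by norm_num)
    rw [Complex.ofReal_ofNat] at this
    rw [this]
    norm_num
    positivity
  exact nonneg_of_mul_nonneg_left (h2.trans h)
    (Real.rpow_pos_of_pos (norm_pos_iff.2 (by norm_num)) _)

/-- For `|z| < 1` the quotient `ln |E_n(z)| / |z|^{n+1}` is at most its value at the point of the
critical curve on the unit circle, where the exponent of `|z|` does not matter. -/
lemma growthConst_one_le (hn : 1 ≤ n) (hα0 : 0 ≤ α) (hα1 : α ≤ 1) :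
    growthConst n 1 ≤ growthConst n α := by
  have hC := growthConst_nonneg hn hα0 hα1
  refine growthConst_le fun z hz0 hz1 => ?_
  have hr := norm_pos_iff.2 hz0
  rcases le_or_gt 1 ‖z‖ with h | h
  · exact (logFactor_le_growthConst_mul hn hα0 hα1 hz0 hz1).trans (mul_le_mul_of_nonneg_left
      (Real.rpow_le_rpow_of_exponent_le h (by linarith)) hC)
  · have hsup := one_lt_succ_div hn
    obtain ⟨θ, hθ, hlt, hrad⟩ := exists_critRadius_eq hn hr (h.trans hsup)
    obtain ⟨η, hη, hηlt, hηrad⟩ := exists_critRadius_eq hn one_pos hsup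
    have hηθ : η ≤ θ := by
      refine le_of_lt (((critRadius_strictAntiOn hn).lt_iff_gt hθ hη).1 ?_)
      rw [hrad, hηrad]
      exact h
    have hquot := logFactor_critPoint_div_antitone hn ⟨hη.1, hηlt⟩ ⟨hθ.1, hlt⟩ hηθ
    simp only [hrad, hηrad, one_pow, div_one] at hquot
    have hnorm : ‖critPoint n η‖ = 1 := (norm_critPoint hn hη).trans hηrad
    have hone : logFactor n (critPoint n η) ≤ growthConst n α := by
      have := logFactor_le_growthConst_mul hn hα0 hα1 (z := critPoint n η)
        (norm_pos_iff.1 (by rw [hnorm]; exact one_pos)) (critPoint_ne_one hn hη)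
      rwa [hnorm, Real.one_rpow, mul_one] at this
    have hle := (logFactor_le_iff n hz1 (critPoint_ne_one hn hθ)).2
      (norm_primaryFactor_le_critPoint hn hθ hrad.symm)
    have hpow : ‖z‖ ^ ((n : ℝ) + 1) = ‖z‖ ^ (n + 1) := by
      rw [← Real.rpow_natCast]; push_cast; rfl
    rw [hpow, ← div_le_iff₀ (pow_pos hr _)]
    exact (div_le_div_of_nonneg_right hle (by positivity)).trans (hquot.trans hone)

lemma growthConst_le_interpolation (hn : 1 ≤ n) (hα0 : 0 ≤ α) (hα1 : α ≤ 1) :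
    growthConst n α ≤ (1 - α) * growthConst n 0 + α * growthConst n 1 := by
  have hC0 := growthConst_nonneg hn le_rfl zero_le_one
  have hC1 := growthConst_nonneg hn zero_le_one le_rfl
  refine growthConst_le fun z hz0 hz1 => ?_
  have hr := norm_pos_iff.2 hz0
  have hrhs : 0 ≤ (1 - α) * growthConst n 0 + α * growthConst n 1 :=
    add_nonneg (mul_nonneg (by linarith) hC0) (mul_nonneg hα0 hC1)
  rcases le_total (logFactor n z) 0 with hneg | hpos
  · exact hneg.trans (mul_nonneg hrhs (Real.rpow_nonneg hr.le _))
  have h0 := logFactor_le_growthConst_mul hn le_rfl zero_le_one hz0 hz1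
  have h1 := logFactor_le_growthConst_mul hn zero_le_one le_rfl hz0 hz1
  rw [← div_le_iff₀ (Real.rpow_pos_of_pos hr _)] at h0 h1 ⊢
  rw [add_zero] at h0
  rw [Real.rpow_add hr, Real.rpow_one, ← div_div] at h1
  rw [Real.rpow_add hr, ← div_div]
  set q := logFactor n z / ‖z‖ ^ (n : ℝ)
  have hq : 0 ≤ q := div_nonneg hpos (Real.rpow_nonneg hr.le _)
  have hamgm := Real.geom_mean_le_arith_mean2_weighted (sub_nonneg.2 hα1) hα0 zero_le_one
    (inv_nonneg.2 hr.le) (sub_add_cancel 1 α)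
  rw [Real.one_rpow, one_mul, mul_one, Real.inv_rpow hr.le] at hamgm
  calc q / ‖z‖ ^ α = q * (‖z‖ ^ α)⁻¹ := div_eq_mul_inv _ _
    _ ≤ q * (1 - α + α * ‖z‖⁻¹) := mul_le_mul_of_nonneg_left hamgm hq
    _ = (1 - α) * q + α * (q / ‖z‖) := by rw [div_eq_mul_inv]; ring
    _ ≤ (1 - α) * growthConst n 0 + α * growthConst n 1 :=
      add_le_add (mul_le_mul_of_nonneg_left h0 (by linarith)) (mul_le_mul_of_nonneg_left h1 hα0)

lemma growthConst_zero_le {C : ℝ} (h : ∀ z : ℂ, z ≠ 1 → logFactor n z ≤ C * ‖z‖ ^ n) :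
    growthConst n 0 ≤ C :=
  growthConst_le fun z _ hz1 => by
    rw [add_zero, Real.rpow_natCast]
    exact h z hz1

lemma growthConst_one_le_of_le {C : ℝ}
    (h : ∀ z : ℂ, z ≠ 1 → logFactor n z ≤ C * ‖z‖ ^ (n + 1)) : growthConst n 1 ≤ C :=
  growthConst_le fun z _ hz1 => by
    have hpow : ‖z‖ ^ ((n : ℝ) + 1) = ‖z‖ ^ (n + 1) := by
      rw [← Real.rpow_natCast]; push_cast; rfl
    rw [hpow]
    exact h z hz1

end

theorem mainTheorem3 :
    ∃ x₀ : ℝ,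
      (0 < x₀ ∧ Real.exp x₀ / x₀ - expIntegralEi x₀ = 0 ∧
        ∀ x : ℝ, 0 < x → Real.exp x / x - expIntegralEi x = 0 → x = x₀) ∧
      ∀ α : ℝ, 0 ≤ α → α ≤ 1 →
        (∀ n : ℕ, 1 ≤ n →
          BddAbove (growthValues n α) ∧
          growthConst n 1 ≤ growthConst n α ∧
          growthConst n α ≤ (1 - α) * growthConst n 0 + α * growthConst n 1) ∧
        growthConst 1 α ≤ (1 - α) * (1 + lambertW (Real.exp (-1))) + α / 2 ∧
        (∀ n : ℕ, 2 ≤ n →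
          growthConst n α ≤ 1 - α * (1 - min x₀⁻¹ ((n : ℝ) / ((n : ℝ) + 1))) ∧
          1 - α * (1 - min x₀⁻¹ ((n : ℝ) / ((n : ℝ) + 1))) ≤ 1) := by
  obtain ⟨x₀, hx₀, hzero, huniq⟩ := exists_unique_zero_exp_div_sub_expIntegralEi
  refine ⟨x₀, ⟨hx₀, hzero, huniq⟩, fun α hα0 hα1 => ⟨fun n hn =>
    ⟨bddAbove_growthValues hn hα0 hα1, growthConst_one_le hn hα0 hα1,
      growthConst_le_interpolation hn hα0 hα1⟩, ?_, fun n hn => ⟨?_, ?_⟩⟩⟩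
  · have h := growthConst_le_interpolation le_rfl hα0 hα1
    have h0 : growthConst 1 0 ≤ 1 + lambertW (Real.exp (-1)) :=
      growthConst_zero_le fun z hz => by rw [pow_one]; exact logFactor_one_le hz
    have h1 : growthConst 1 1 ≤ 1 / 2 := growthConst_one_le_of_le fun z hz => by
      have := logFactor_le_div le_rfl hz
      norm_num at this ⊢
      exact this
    have h0' := mul_le_mul_of_nonneg_left h0 (sub_nonneg.2 hα1)
    have h1' := mul_le_mul_of_nonneg_left h1 hα0
    linarith
  · have hn1 : 1 ≤ n := by omega
    have h := growthConst_le_interpolation hn1 hα0 hα1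
    have h0 : growthConst n 0 ≤ 1 :=
      growthConst_zero_le fun z hz => by rw [one_mul]; exact logFactor_le_pow hn hz
    have h1 : growthConst n 1 ≤ min x₀⁻¹ ((n : ℝ) / ((n : ℝ) + 1)) :=
      le_min (growthConst_one_le_of_le fun z hz => logFactor_le_pow_div hx₀ hzero hn1 hz)
        (growthConst_one_le_of_le fun z hz => logFactor_le_div hn1 hz)
    have h0' := mul_le_mul_of_nonneg_left h0 (sub_nonneg.2 hα1)
    have h1' := mul_le_mul_of_nonneg_left h1 hα0
    linarith
  · have hle : min x₀⁻¹ ((n : ℝ) / ((n : ℝ) + 1)) ≤ 1 :=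
      (min_le_right _ _).trans (div_le_one_of_le₀ (by linarith) (by positivity))
    have := mul_nonneg hα0 (sub_nonneg.2 hle)
    linarith
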